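/- Let $\Omega=\{0,1\}^{\mathbb N}$ be the Cantor space. For a finite bit string $x$, let $[x]\subset\Omega$ be the interval consisting of all infinite sequences with prefix $x$. A subset of $\Omega$ (or of $\Omega\times\Omega$) is effectively open if it is the union of a computably enumerable family of intervals $[x]$ (respectively, of products $[x]\times[y]$), and effectively closed if its complement is effectively open. A function $t\colon\Omega\to[0,\infty]$ is lower semicomputable if the sets $\{\omega: t(\omega)>r\}$ are effectively open uniformly in the rational number $r\ge 0$. A probability distribution $P$ on $\Omega$ is computable if $P([x])$ can be computed with any given precision from $x$. Let $\mathcal L$ be a class of probability distributions on $\Omega$. An expectation-bounded $\mathcal L$-test is a lower semicomputable $t\colon\Omega\to[0,\infty]$ with $\int t\,dQ\le 1$ for every $Q\in\mathcal L$; if $t_{\mathcal L}$ is such a test that is maximal up to a constant factor, then $d_{\mathcal L}(\omega)=\log_2 t_{\mathcal L}(\omega)$ is called the expectation-bounded deficiency with respect to $\mathcal L$. A Martin-Löf $\mathcal L$-test is a decreasing sequence $U_1\supset U_2\supset\dots$ of uniformly effectively open sets with $Q(U_i)\le 2^{-i}$ for all $Q\in\mathcal L$ and all $i$; it has the deficiency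 function $\omega\mapsto\sup\{i:\omega\in U_i\}$ (with $\sup\emptyset=0$). If this function is maximal up to an additive constant among all Martin-Löf $\mathcal L$-tests, the test is called universal and the function $d_{\mathcal L}$ thus obtained is called the probability-bounded deficiency with respect to $\mathcal L$. For a single distribution $P$ we let $d_P=d_{\{P\}}$. A sequence is $P$-random (Martin-Löf random with respect to $P$) if for every Martin-Löf $\{P\}$-test it lies outside some $U_i$. A sequence $\omega$ is $\mathcal L$-random if $t_{\mathcal L}(\omega)<\infty$. Theorem. Let $P$ be a computable probability distribution on $\Omega$, and let $F\subset\Omega\times\Omega$ be such that (i) $F$ is effectively closed; (ii) for every $\alpha\in\Omega$ there is some $\beta\in\Omega$ with $(\alpha,\beta)\in F$; (iii) for every string $y$ the set $\{\alpha:\exists\beta\in[y],\ (\alpha,\beta)\in F\}$ is a finite union of intervals, and a list of these intervals can be computed from $y$. Let $\mathcal L$ be the class of all distributions $Q$ on $\Omega$ that are $F$-couplable with $P$, i.e., for which there is a probability distribution $S$ on $\Omega\times\Omega$ with $S((\Omega\times\Omega)\setminus F)=0$, with first marginal $P$ and with second marginal $Q$. Then, both for the expectation-bounded and for the probability-bounded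 version of deficiency, maximal (respectively, universal) tests with respect to $P$ and with respect to $\mathcal L$ exist, and for any choice of them $$d_{\mathcal L}(\beta)=\inf\{d_P(\alpha) : (\alpha,\beta)\in F\}+O(1),$$ where $\inf\emptyset=+\infty$ and the constant in $O(1)$ does not depend on $\beta\in\Omega$ (it may depend on $P$, on $F$ and on the chosen tests). In particular, a sequence $\beta$ is $\mathcal L$-random if and only if $(\alpha,\beta)\in F$ for some $P$-random sequence $\alpha$; the same is true if $\mathcal L$-randomness is understood as not being rejected (contained in all $U_i$) by any Martin-Löf $\mathcal L$-test. -/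

import Mathlib

open scoped ENNReal NNReal

namespace AlgRand

/-- The Cantor space of infinite bit sequences (with its product topology and product
`σ`-algebra, which is its Borel `σ`-algebra). -/
abbrev Cantor : Type := ℕ → Bool

/-- A probability distribution on the Cantor space. -/
abbrev Distribution : Type := MeasureTheory.ProbabilityMeasure Cantor

/-- The interval `[x]`: all infinite sequences that have the string `x` as a prefix. -/
def interval (x : List Bool) : Set Cantor :=
  {ω | ∀ i : Fin x.length, ω i = x.get i}

/-- A family of subsets of the Cantor space is uniformly effectively open: given the index `i`,
one can enumerate strings whose intervals have union `U i`. -/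
def UniformlyEffectivelyOpen {ι : Type} [Primcodable ι] (U : ι → Set Cantor) : Prop :=
  ∃ A : ι × List Bool → Prop, REPred A ∧ ∀ i, U i = {ω | ∃ x, A (i, x) ∧ ω ∈ interval x}

/-- `F` is effectively closed in the product: its complement is the union of an enumerable family
of products of intervals. -/
def EffectivelyClosed (F : Set (Cantor × Cantor)) : Prop :=
  ∃ A : List Bool × List Bool → Prop, REPred A ∧
    Fᶜ = {p | ∃ x y, A (x, y) ∧ p.1 ∈ interval x ∧ p.2 ∈ interval y}

/-- The `F`-preimage of a set `V`. -/
def relPreimage (F : Set (Cantor × Cantor)) (V : Set Cantor) : Set Cantor :=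
  {α | ∃ β ∈ V, (α, β) ∈ F}

/-- The `F`-preimage of every interval `[y]` is a finite union of intervals, and a list of such
intervals can be computed given `y`. -/
def ComputableClopenPreimages (F : Set (Cantor × Cantor)) : Prop :=
  ∃ g : List Bool → List (List Bool), Computable g ∧
    ∀ y, relPreimage F (interval y) = {α | ∃ x ∈ g y, α ∈ interval x}

/-- `P` is computable: given a string `x` and a precision `n`, one can compute a rational
`2⁻ⁿ`-approximation (here with denominator `2ⁿ`) to the probability of `[x]`. -/
def ComputableDistribution (P : Distribution) : Prop :=
  ∃ f : List Bool → ℕ → ℕ, Computable₂ f ∧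
    ∀ x n, |(P : MeasureTheory.Measure Cantor).real (interval x) - (f x n : ℝ) / 2 ^ n|
      ≤ 1 / 2 ^ n

/-- The class of all distributions that are `F`-couplable with `P`: second marginals of
distributions `S` on the product that are concentrated inside `F` and have first marginal `P`. -/
def couplable (F : Set (Cantor × Cantor)) (P : Distribution) : Set Distribution :=
  {Q | ∃ S : MeasureTheory.ProbabilityMeasure (Cantor × Cantor),
    (S : MeasureTheory.Measure (Cantor × Cantor)) Fᶜ = 0 ∧
    (S : MeasureTheory.Measure (Cantor × Cantor)).map Prod.fst = P ∧
    (S : MeasureTheory.Measure (Cantor × Cantor)).map Prod.snd = Q}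

/-- A function with values in `[0, ∞]` is lower semicomputable: the sets `{t > r}` are effectively
open, uniformly in the rational number `r = a / (b + 1) ≥ 0`. -/
def LowerSemicomputable (t : Cantor → ℝ≥0∞) : Prop :=
  UniformlyEffectivelyOpen fun r : ℕ × ℕ => {ω | (r.1 : ℝ≥0∞) / ((r.2 : ℝ≥0∞) + 1) < t ω}

/-! ### Expectation-bounded tests

Tests with respect to a single distribution `P` are tests with respect to the class `{P}`. -/

/-- Expectation-bounded test with respect to a class of distributions. -/
def IsExpTest (𝓛 : Set Distribution) (t : Cantor → ℝ≥0∞) : Prop :=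
  LowerSemicomputable t ∧ ∀ Q ∈ 𝓛, ∫⁻ ω, t ω ∂(Q : MeasureTheory.Measure Cantor) ≤ 1

/-- Expectation-bounded test that is maximal up to a constant factor. -/
def IsMaximalExpTest (𝓛 : Set Distribution) (t : Cantor → ℝ≥0∞) : Prop :=
  IsExpTest 𝓛 t ∧ ∀ t', IsExpTest 𝓛 t' → ∃ c : ℝ≥0, ∀ ω, t' ω ≤ c * t ω

/-- The deficiency `log₂ t(ω)` given by an expectation-bounded test `t`; it takes values in
`[-∞, ∞]`. -/
noncomputable def expDeficiency (t : Cantor → ℝ≥0∞) (ω : Cantor) : EReal :=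
  ENNReal.log (t ω) / ((Real.log 2 : ℝ) : EReal)

/-- `ω` is random with respect to the class `𝓛`: the maximal expectation-bounded test is finite
at `ω`. -/
def IsClassRandom (𝓛 : Set Distribution) (ω : Cantor) : Prop :=
  ∃ t, IsMaximalExpTest 𝓛 t ∧ t ω < ⊤

/-! ### Probability-bounded (Martin-Löf) tests -/

/-- Martin-Löf test with respect to a class of distributions. The set `U 0` is present for
convenience only: its bound is trivial, and it does not influence
the deficiency. -/
def IsMLTest (𝓛 : Set Distribution) (U : ℕ → Set Cantor) : Prop :=
  Antitone U ∧ UniformlyEffectivelyOpen U ∧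
    ∀ Q ∈ 𝓛, ∀ i, (Q : MeasureTheory.Measure Cantor) (U i) ≤ 2⁻¹ ^ i

/-- The deficiency `sup {i | ω ∈ U i}` given by a Martin-Löf test `U`. -/
noncomputable def mlDeficiency (U : ℕ → Set Cantor) (ω : Cantor) : ℕ∞ :=
  ⨆ i ∈ {i : ℕ | ω ∈ U i}, (i : ℕ∞)

/-- Universal Martin-Löf test: its deficiency is maximal up to an additive constant. -/
def IsUniversalMLTest (𝓛 : Set Distribution) (U : ℕ → Set Cantor) : Prop :=
  IsMLTest 𝓛 U ∧
    ∀ V, IsMLTest 𝓛 V → ∃ c : ℕ, ∀ ω, mlDeficiency V ω ≤ mlDeficiency U ω + c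

/-- `ω` is Martin-Löf random with respect to the class `𝓛`: no Martin-Löf test rejects it. -/
def IsMLRandom (𝓛 : Set Distribution) (ω : Cantor) : Prop :=
  ∀ U, IsMLTest 𝓛 U → ∃ i, ω ∉ U i

end AlgRand

open AlgRand

open MeasureTheory Filter Topology
open AlgRand

/-!
Everything rests on two transformations of tests along the relation `F`.

If `t` is a test with respect to the class of couplable distributions, then
`α ↦ sup {t β | (α, β) ∈ F}` is a test with respect to `P`. It is lower semicomputable because the
`F`-preimages of intervals are computable finite unions of intervals. Its `P`-integral is bounded
because the supremum is approached by `t (s α)` for measurable selectors `s` of `F`, and the image of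
`P` under a selector is couplable with `P` (`lintegral_iSup_section_le`).

If `t` is a test with respect to `P`, then `β ↦ inf {t α | (α, β) ∈ F}` is a test with respect to the
class. Its integral over a distribution `Q` is bounded by integrating `t` over a coupling of `P` and
`Q`. It is lower semicomputable because `F` is effectively closed and the Cantor space is compact
(`UniformlyEffectivelyOpen.relCore`); for the same reason the infimum over a nonempty section is
attained (`exists_eq_infSection`).

Applied to maximal tests, the first transformation gives `t_𝓛 β ≤ c * t_P α` on `F`, and the second
one gives `inf {t_P α | (α, β) ∈ F} ≤ c * t_𝓛 β`. Moreover, the second transformation turns a maximal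
`P`-test into a maximal test for the class. Martin-Löf tests are treated in the same way, level by
level.

It remains to construct the maximal tests for the single computable distribution `P`. Every
effectively open family is a computably enumerable union of disjoint intervals
(`UniformlyEffectivelyOpen.exists_disjoint`), so that the constraints on tests become bounds on sums
of weights `2 ^ k * P [x]`. All enumerable sets of strings are run in parallel, and the elements of
each of them are released only once the total weight is confirmed to be small (`TrimmedMem`). This
bounds the weight of every set on the list and changes none of those that come from genuine tests.

The equivalence of both notions of randomness holds for any class with a maximal
expectation-bounded test (`isMLRandom_iff_lt_top`): the levels `{2 ^ i < t}` form a Martin-Löf test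
by Markov's inequality, and the deficiency of a Martin-Löf test is itself an expectation-bounded
test.
-/

/-! ### Closure properties of decidable and enumerable predicates -/

section Computability

variable {α β : Type} [Primcodable α] [Primcodable β]

theorem ComputablePred.comp' {p : β → Prop} (hp : ComputablePred p) {f : α → β}
    (hf : Computable f) : ComputablePred fun a => p (f a) := by
  obtain ⟨hd, hc⟩ := hp
  exact ⟨fun a => hd (f a), hc.comp hf⟩

theorem ComputablePred.and' {p q : α → Prop} (hp : ComputablePred p) (hq : ComputablePred q) :
    ComputablePred fun a => p a ∧ q a := by
  obtain ⟨_, hp⟩ := hp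
  obtain ⟨_, hq⟩ := hq
  refine ⟨inferInstance, (Primrec.and.to_comp.comp hp hq).of_eq fun a => ?_⟩
  simp

theorem ComputablePred.eq_comp [DecidableEq β] {f g : α → β} (hf : Computable f)
    (hg : Computable g) : ComputablePred fun a => f a = g a :=
  (PrimrecPred.computablePred (Primrec.eq (α := β))).comp' (f := fun a => (f a, g a)) (hf.pair hg)

theorem ComputablePred.lt_comp {f g : α → ℕ} (hf : Computable f) (hg : Computable g) :
    ComputablePred fun a => f a < g a :=
  (PrimrecPred.computablePred Primrec.nat_lt).comp' (f := fun a => (f a, g a)) (hf.pair hg)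

theorem Computable.sum_range {h : α → ℕ → ℕ} (hh : Computable₂ h) {N : α → ℕ}
    (hN : Computable N) : Computable fun a => ∑ j ∈ Finset.range (N a), h a j := by
  have : Computable₂ fun (a : α) (p : ℕ × ℕ) => p.2 + h a p.1 :=
    Primrec.nat_add.to_comp.comp (Computable.snd.comp Computable.snd)
      (hh.comp Computable.fst (Computable.fst.comp Computable.snd))
  refine (Computable.nat_rec hN (Computable.const 0) this).of_eq fun a => ?_
  induction N a with
  | zero => rfl
  | succ n ih => rw [Finset.sum_range_succ, ← ih]

theorem Computable.ite' {p : α → Prop} [DecidablePred p] (hp : ComputablePred p) {f g : α → β}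
    (hf : Computable f) (hg : Computable g) : Computable fun a => if p a then f a else g a := by
  refine (Computable.cond hp.decide hf hg).of_eq fun a => ?_
  by_cases h : p a <;> simp [h]

theorem ComputablePred.exists_lt' {p : α × ℕ → Prop} (hp : ComputablePred p) {N : α → ℕ}
    (hN : Computable N) : ComputablePred fun a => ∃ j < N a, p (a, j) := by
  classical
  have h1 : Computable₂ fun (a : α) (j : ℕ) => if p (a, j) then 1 else 0 :=
    Computable.ite' hp (Computable.const 1) (Computable.const 0)
  have h2 := ComputablePred.lt_comp (Computable.const 0) (Computable.sum_range h1 hN)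
  refine h2.of_eq fun a => ?_
  simp [Finset.filter_nonempty_iff]

theorem ComputablePred.forall_lt' {p : α × ℕ → Prop} (hp : ComputablePred p) {N : α → ℕ}
    (hN : Computable N) : ComputablePred fun a => ∀ j < N a, p (a, j) := by
  refine (hp.not.exists_lt' hN).not.of_eq fun a => ?_
  push Not
  rfl

theorem REPred.exists_code {A : α → Prop} (h : REPred A) :
    ∃ c : Nat.Partrec.Code, ∀ a, A a ↔ ∃ n, (c.evaln n (Encodable.encode a)).isSome := by
  obtain ⟨c, hc⟩ := Nat.Partrec.Code.exists_code.1 h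
  refine ⟨c, fun a => ?_⟩
  have h2 : (c.eval (Encodable.encode a)).Dom ↔ A a := by
    rw [hc]
    simp [Part.assert]
  rw [← h2, Part.dom_iff_mem]
  simp only [Nat.Partrec.Code.evaln_complete, Option.isSome_iff_exists, Option.mem_def]
  exact exists_comm

/-- A predicate is enumerable as soon as it is the projection of a decidable one along any
effectively coded type. -/
theorem ComputablePred.re_exists {p : α × β → Prop} (hp : ComputablePred p) :
    REPred fun a => ∃ b, p (a, b) := by
  obtain ⟨_, hp⟩ := hp
  have h1 : Computable₂ fun (a : α) (n : ℕ) =>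
      ((Encodable.decode (α := β) n).map fun b => decide (p (a, b))).getD false :=
    Computable.option_getD (Computable.option_map (Computable.decode.comp Computable.snd)
      (hp.comp ((Computable.fst.comp Computable.fst).pair Computable.snd)).to₂)
      (Computable.const false)
  refine (Partrec.dom_re (Partrec.rfind h1.partrec₂)).of_eq fun a => ?_
  rw [Nat.rfind_dom]
  constructor
  · rintro ⟨n, h, -⟩
    simp only [Part.mem_some_iff, PFun.coe_val] at h
    cases hd : Encodable.decode (α := β) n with
    | none => simp [hd] at h
    | some b => exact ⟨b, by simpa [hd] using h.symm⟩
  · rintro ⟨b, hb⟩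
    exact ⟨Encodable.encode b, by simp [hb], fun _ => trivial⟩

theorem computablePred_evaln_isSome {c : α → Nat.Partrec.Code} {s n : α → ℕ}
    (hc : Computable c) (hs : Computable s) (hn : Computable n) :
    ComputablePred fun a => ((c a).evaln (s a) (n a)).isSome := by
  refine ⟨inferInstance, ?_⟩
  refine (Primrec.option_isSome.to_comp.comp (Nat.Partrec.Code.primrec_evaln.to_comp.comp
    ((hs.pair hc).pair hn))).of_eq fun a => ?_
  simp

theorem rePred_iff_exists_nat {A : α → Prop} :
    REPred A ↔ ∃ D : α × ℕ → Prop, ComputablePred D ∧ ∀ a, A a ↔ ∃ n, D (a, n) := by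
  constructor
  · intro h
    obtain ⟨c, hc⟩ := REPred.exists_code h
    exact ⟨fun p => (c.evaln p.2 (Encodable.encode p.1)).isSome,
      computablePred_evaln_isSome (Computable.const c) Computable.snd
        (Computable.encode.comp Computable.fst), hc⟩
  · rintro ⟨D, hD, h⟩
    exact hD.re_exists.of_eq fun a => (h a).symm

theorem REPred.comp' {p : β → Prop} (hp : REPred p) {f : α → β}
    (hf : Computable f) : REPred fun a => p (f a) :=
  Partrec.comp hp hf

theorem REPred.exists' {p : α × β → Prop} (hp : REPred p) : REPred fun a => ∃ b, p (a, b) := by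
  obtain ⟨D, hD, h⟩ := rePred_iff_exists_nat.1 hp
  have : ComputablePred fun q : α × β × ℕ => D ((q.1, q.2.1), q.2.2) :=
    hD.comp' ((Computable.fst.pair (Computable.fst.comp Computable.snd)).pair
      (Computable.snd.comp Computable.snd))
  refine this.re_exists.of_eq fun a => ?_
  simp [h]

theorem REPred.and' {p q : α → Prop} (hp : REPred p) (hq : REPred q) :
    REPred fun a => p a ∧ q a := by
  obtain ⟨D, hD, h⟩ := rePred_iff_exists_nat.1 hp
  obtain ⟨E, hE, h'⟩ := rePred_iff_exists_nat.1 hq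
  have : ComputablePred fun r : α × ℕ × ℕ => D (r.1, r.2.1) ∧ E (r.1, r.2.2) :=
    (hD.comp' (Computable.fst.pair (Computable.fst.comp Computable.snd))).and'
      (hE.comp' (Computable.fst.pair (Computable.snd.comp Computable.snd)))
  refine this.re_exists.of_eq fun a => ?_
  simp [h, h']

theorem REPred.or' {p q : α → Prop} (hp : REPred p) (hq : REPred q) :
    REPred fun a => p a ∨ q a := by
  obtain ⟨D, hD, h⟩ := rePred_iff_exists_nat.1 hp
  obtain ⟨E, hE, h'⟩ := rePred_iff_exists_nat.1 hq
  have : ComputablePred fun r : α × ℕ => ¬ (¬ D r ∧ ¬ E r) := (hD.not.and' hE.not).not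
  refine this.re_exists.of_eq fun a => ?_
  simp only [h, h', ← exists_or]
  exact exists_congr fun _ => by tauto

theorem REPred.forall_lt' {p : α × ℕ → Prop} (hp : REPred p) {N : α → ℕ} (hN : Computable N) :
    REPred fun a => ∀ j < N a, p (a, j) := by
  obtain ⟨D, hD, h⟩ := rePred_iff_exists_nat.1 hp
  have h1 : ComputablePred fun r : (α × ℕ) × ℕ => ∃ n < r.1.2, D ((r.1.1, r.2), n) :=
    (hD.comp' (f := fun r : ((α × ℕ) × ℕ) × ℕ => ((r.1.1.1, r.1.2), r.2))
      (((Computable.fst.comp (Computable.fst.comp Computable.fst)).pair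
        (Computable.snd.comp Computable.fst)).pair Computable.snd)).exists_lt'
      (Computable.snd.comp Computable.fst)
  refine (h1.forall_lt' (hN.comp Computable.fst)).re_exists.of_eq fun a => ?_
  simp only [h]
  constructor
  · rintro ⟨M, hM⟩ j hj
    obtain ⟨n, -, hn⟩ := hM j hj
    exact ⟨n, hn⟩
  · intro H
    choose! n hn using H
    refine ⟨∑ j ∈ Finset.range (N a), n j + 1, fun j hj => ⟨n j, ?_, hn j hj⟩⟩
    have := Finset.single_le_sum (f := n) (fun i _ => Nat.zero_le _) (Finset.mem_range.2 hj)
    omega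

theorem REPred.forall_mem_list {p : α × β → Prop} (hp : REPred p) {l : α → List β}
    (hl : Computable l) : REPred fun a => ∀ b ∈ l a, p (a, b) := by
  have h1 : REPred fun r : α × ℕ => ∃ b, (l r.1)[r.2]? = some b ∧ p (r.1, b) := by
    classical
    have : REPred fun r : (α × ℕ) × β => (l r.1.1)[r.1.2]? = some r.2 ∧ p (r.1.1, r.2) :=
      (ComputablePred.eq_comp (Computable.list_getElem?.comp
        (hl.comp (Computable.fst.comp Computable.fst)) (Computable.snd.comp Computable.fst))
        (Computable.option_some.comp Computable.snd)).to_re.and'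
        (hp.comp' ((Computable.fst.comp Computable.fst).pair Computable.snd))
    exact this.exists'
  refine (h1.forall_lt' (Computable.list_length.comp hl)).of_eq fun a => ?_
  constructor
  · intro H b hb
    obtain ⟨n, hn, rfl⟩ := List.mem_iff_getElem.1 hb
    obtain ⟨b, hb, h⟩ := H n hn
    rw [List.getElem?_eq_getElem hn] at hb
    cases hb
    exact h
  · intro H n hn
    exact ⟨(l a)[n], List.getElem?_eq_getElem hn, H _ (List.getElem_mem hn)⟩

theorem rePred_mem_list {l : α → List β} (hl : Computable l) {f : α → β} (hf : Computable f) :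
    REPred fun a => f a ∈ l a := by
  classical
  have : ComputablePred fun r : α × ℕ => (l r.1)[r.2]? = some (f r.1) :=
    ComputablePred.eq_comp (Computable.list_getElem?.comp (hl.comp Computable.fst) Computable.snd)
      (Computable.option_some.comp (hf.comp Computable.fst))
  exact this.re_exists.of_eq fun a => by simp only [List.mem_iff_getElem?]

theorem rePred_prefix {f g : α → List β} (hf : Computable f) (hg : Computable g) :
    REPred fun a => f a <+: g a := by
  classical
  have : ComputablePred fun r : α × List β => f r.1 ++ r.2 = g r.1 :=
    ComputablePred.eq_comp (Computable.list_append.comp (hf.comp Computable.fst) Computable.snd)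
      (hg.comp Computable.fst)
  exact this.re_exists

theorem Computable.two_pow {f : α → ℕ} (hf : Computable f) : Computable fun a => 2 ^ f a := by
  have : Computable₂ fun (_ : α) (p : ℕ × ℕ) => 2 * p.2 :=
    Primrec.nat_mul.to_comp.comp (Computable.const 2) (Computable.snd.comp Computable.snd)
  refine (Computable.nat_rec hf (Computable.const 1) this).of_eq fun a => ?_
  induction f a with
  | zero => rfl
  | succ n ih => rw [pow_succ, mul_comm, ← ih]

end Computability

/-! ### Prefixes, intervals and effectively open families -/

/-- The prefix of length `n` of an infinite sequence. -/
def cantorPrefix (ω : Cantor) (n : ℕ) : List Bool := (List.range n).map ω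

@[simp] theorem length_cantorPrefix (ω : Cantor) (n : ℕ) : (cantorPrefix ω n).length = n := by
  simp [cantorPrefix]

theorem mem_interval_iff {ω : Cantor} {x : List Bool} :
    ω ∈ interval x ↔ cantorPrefix ω x.length = x := by
  constructor
  · intro h
    refine List.ext_getElem (by simp) fun i h1 h2 => ?_
    simpa [cantorPrefix] using h ⟨i, h2⟩
  · intro h i
    have := List.getElem_of_eq h.symm i.2
    simpa [cantorPrefix] using this.symm

theorem mem_interval_cantorPrefix (ω : Cantor) (n : ℕ) : ω ∈ interval (cantorPrefix ω n) := by
  simp [mem_interval_iff]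

theorem take_cantorPrefix (ω : Cantor) {m n : ℕ} (h : m ≤ n) :
    (cantorPrefix ω n).take m = cantorPrefix ω m := by
  simp [cantorPrefix, ← List.map_take, List.take_range, h]

theorem cantorPrefix_prefix (ω : Cantor) {m n : ℕ} (h : m ≤ n) :
    cantorPrefix ω m <+: cantorPrefix ω n := by
  rw [← take_cantorPrefix ω h]
  exact List.take_prefix _ _

theorem interval_anti {x y : List Bool} (h : x <+: y) : interval y ⊆ interval x := by
  intro ω hω
  rw [mem_interval_iff] at hω ⊢
  rw [← take_cantorPrefix ω h.length_le, hω]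
  exact (List.prefix_iff_eq_take.1 h).symm

theorem prefix_cantorPrefix_iff {ω : Cantor} {x : List Bool} {n : ℕ} :
    x <+: cantorPrefix ω n ↔ x.length ≤ n ∧ ω ∈ interval x := by
  constructor
  · intro h
    exact ⟨by simpa using h.length_le, interval_anti h (mem_interval_cantorPrefix ω n)⟩
  · rintro ⟨h1, h2⟩
    rw [← mem_interval_iff.1 h2]
    exact cantorPrefix_prefix ω h1

@[simp] theorem interval_nil : interval [] = Set.univ := by
  ext ω
  simp [mem_interval_iff, cantorPrefix]

theorem isClopen_interval (x : List Bool) : IsClopen (interval x) := by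
  have : interval x = ⋂ i : Fin x.length, (fun ω : Cantor => ω i) ⁻¹' {x.get i} := by
    ext ω
    simp [interval]
  rw [this]
  exact isClopen_iInter_of_finite fun i => (isClopen_discrete _).preimage (continuous_apply _)

theorem measurableSet_interval (x : List Bool) : MeasurableSet (interval x) :=
  (isClopen_interval x).isOpen.measurableSet

section EffectivelyOpen

variable {ι κ : Type} [Primcodable ι] [Primcodable κ]

theorem AlgRand.UniformlyEffectivelyOpen.isOpen {U : ι → Set Cantor}
    (h : UniformlyEffectivelyOpen U) (i : ι) : IsOpen (U i) := by
  obtain ⟨A, -, hA⟩ := h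
  have : U i = ⋃ x, ⋃ _ : A (i, x), interval x := by
    rw [hA]
    ext ω
    simp
  rw [this]
  exact isOpen_iUnion fun x => isOpen_iUnion fun _ => (isClopen_interval x).isOpen

theorem AlgRand.UniformlyEffectivelyOpen.measurableSet {U : ι → Set Cantor}
    (h : UniformlyEffectivelyOpen U) (i : ι) : MeasurableSet (U i) :=
  (h.isOpen i).measurableSet

theorem AlgRand.UniformlyEffectivelyOpen.comp {U : ι → Set Cantor}
    (h : UniformlyEffectivelyOpen U) {f : κ → ι} (hf : Computable f) :
    UniformlyEffectivelyOpen fun k => U (f k) := by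
  obtain ⟨A, hA, h⟩ := h
  exact ⟨fun p => A (f p.1, p.2), hA.comp' ((hf.comp Computable.fst).pair Computable.snd),
    fun k => h (f k)⟩

/-- A sufficient condition with a parameter `k`, over which the enumeration may project. -/
theorem uniformlyEffectivelyOpen_of_re {U : ι → Set Cantor} {A : (ι × List Bool) × κ → Prop}
    (hA : REPred A) (h : ∀ i, U i = {ω | ∃ x k, A ((i, x), k) ∧ ω ∈ interval x}) :
    UniformlyEffectivelyOpen U := by
  refine ⟨_, hA.exists', fun i => ?_⟩
  rw [h i]
  ext ω
  simp

/-- Every effectively open family is enumerated by pairwise disjoint intervals: a string is kept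
when some prefix of it is enumerated within as many steps as it has letters, and no shorter string
has this property. -/
theorem AlgRand.UniformlyEffectivelyOpen.exists_disjoint {U : ι → Set Cantor}
    (h : UniformlyEffectivelyOpen U) :
    ∃ A : ι × List Bool → Prop, REPred A ∧
      (∀ i, U i = {ω | ∃ x, A (i, x) ∧ ω ∈ interval x}) ∧
      ∀ i x y, A (i, x) → A (i, y) → x ≠ y → Disjoint (interval x) (interval y) := by
  obtain ⟨A, hA, h⟩ := h
  obtain ⟨D, hD, hAD⟩ := rePred_iff_exists_nat.1 hA
  let G : ι × List Bool → Prop := fun p =>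
    ∃ j < p.2.length + 1, ∃ s < p.2.length + 1, D ((p.1, p.2.take j), s)
  have hG : ComputablePred G := by
    have hl : Computable fun p : ι × List Bool => p.2.length + 1 :=
      Computable.succ.comp (Computable.list_length.comp Computable.snd)
    have h1 : ComputablePred fun p : ((ι × List Bool) × ℕ) × ℕ =>
        D ((p.1.1.1, p.1.1.2.take p.1.2), p.2) := by
      refine hD.comp' (f := fun p : ((ι × List Bool) × ℕ) × ℕ =>
        ((p.1.1.1, p.1.1.2.take p.1.2), p.2)) ?_
      exact (((Computable.fst.comp (Computable.fst.comp Computable.fst)).pair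
        (Primrec.list_take.to_comp.comp (Computable.snd.comp Computable.fst)
          (Computable.snd.comp (Computable.fst.comp Computable.fst)))).pair Computable.snd)
    exact (h1.exists_lt' (hl.comp Computable.fst)).exists_lt' hl
  have hGm : ComputablePred fun p : ι × List Bool =>
      G p ∧ ∀ j < p.2.length, ¬ G (p.1, p.2.take j) := by
    refine hG.and' (ComputablePred.forall_lt' (p := fun q : (ι × List Bool) × ℕ =>
      ¬ G (q.1.1, q.1.2.take q.2)) ?_ (Computable.list_length.comp Computable.snd))
    exact hG.not.comp' (f := fun q : (ι × List Bool) × ℕ => (q.1.1, q.1.2.take q.2))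
      ((Computable.fst.comp Computable.fst).pair
        (Primrec.list_take.to_comp.comp Computable.snd (Computable.snd.comp Computable.fst)))
  refine ⟨_, hGm.to_re, fun i => ?_, fun i x y hx hy hxy => ?_⟩
  · rw [h i]
    ext ω
    simp only [Set.mem_ofPred_eq]
    constructor
    · rintro ⟨x, hx, hω⟩
      obtain ⟨s, hs⟩ := (hAD _).1 hx
      -- A prefix long enough to contain `x` and to leave time for enumerating it.
      have hex : ∃ n, G (i, cantorPrefix ω n) := by
        refine ⟨max x.length s, x.length, ?_, s, ?_, ?_⟩
        · simp only [length_cantorPrefix]; omega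
        · simp only [length_cantorPrefix]; omega
        · simp only [take_cantorPrefix ω (le_max_left _ _), mem_interval_iff.1 hω]
          exact hs
      classical
      refine ⟨cantorPrefix ω (Nat.find hex), ⟨Nat.find_spec hex, fun j hj => ?_⟩,
        mem_interval_cantorPrefix _ _⟩
      simp only [length_cantorPrefix] at hj
      simp only [take_cantorPrefix ω hj.le]
      exact Nat.find_min hex hj
    · rintro ⟨x, ⟨⟨j, -, s, -, hs⟩, -⟩, hω⟩
      exact ⟨x.take j, (hAD _).2 ⟨s, hs⟩, interval_anti (List.take_prefix _ _) hω⟩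
  · rw [Set.disjoint_left]
    intro ω h1 h2
    rw [mem_interval_iff] at h1 h2
    rcases lt_trichotomy x.length y.length with hlt | heq | hlt
    · refine hy.2 _ hlt ?_
      have e : y.take x.length = x := by rw [← h2, take_cantorPrefix ω hlt.le, h1]
      simpa only [e] using hx.1
    · exact hxy (by rw [← h1, ← h2, heq])
    · refine hx.2 _ hlt ?_
      have e : x.take y.length = y := by rw [← h1, take_cantorPrefix ω hlt.le, h2]
      simpa only [e] using hy.1

/-- The measure of a disjoint union of intervals. -/
theorem measure_eq_tsum_interval (μ : Measure Cantor) {V : Set Cantor} {A : List Bool → Prop}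
    (hV : V = {ω | ∃ x, A x ∧ ω ∈ interval x})
    (hd : ∀ x y, A x → A y → x ≠ y → Disjoint (interval x) (interval y)) :
    μ V = ∑' x : {x // A x}, μ (interval x) := by
  have : V = ⋃ x : {x // A x}, interval x := by
    rw [hV]
    ext ω
    simp
  rw [this]
  refine measure_iUnion (fun x y hxy => hd _ _ x.2 y.2 fun h => hxy (Subtype.ext h))
    fun x => measurableSet_interval _

end EffectivelyOpen

/-! ### Lower semicomputable functions -/

theorem ratio_eq_ofReal (a b : ℕ) :
    (a : ℝ≥0∞) / ((b : ℝ≥0∞) + 1) = ENNReal.ofReal (a / (b + 1)) := by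
  rw [ENNReal.ofReal_div_of_pos (by positivity), ENNReal.ofReal_add (by positivity) zero_le_one]
  simp

/-- The fractions `a / (b + 1)` are dense in `[0, ∞]`. -/
theorem exists_ratio_btwn {s t : ℝ≥0∞} (h : s < t) :
    ∃ a b : ℕ, s < (a : ℝ≥0∞) / ((b : ℝ≥0∞) + 1) ∧ (a : ℝ≥0∞) / ((b : ℝ≥0∞) + 1) < t := by
  obtain ⟨q, hq0, hsq, hqt⟩ := ENNReal.lt_iff_exists_rat_btwn.1 h
  have hq : (q : ℝ) = (q.num.toNat : ℕ) / (((q.den - 1 : ℕ) : ℝ) + 1) := by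
    have h1 : ((q.den - 1 : ℕ) : ℝ) + 1 = q.den := by
      have := q.den_pos
      norm_cast
      omega
    have h2 : ((q.num.toNat : ℕ) : ℝ) = (q.num : ℝ) := by
      have := Int.toNat_of_nonneg (Rat.num_nonneg.2 hq0)
      exact_mod_cast congrArg (Int.cast (R := ℝ)) this
    rw [h1, h2]
    exact_mod_cast (Rat.num_div_den q).symm
  refine ⟨q.num.toNat, q.den - 1, ?_, ?_⟩ <;> rw [ratio_eq_ofReal, ← hq] <;> assumption

theorem AlgRand.LowerSemicomputable.isOpen_lt {t : Cantor → ℝ≥0∞}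
    (h : LowerSemicomputable t) (s : ℝ≥0∞) : IsOpen {ω | s < t ω} := by
  have : {ω | s < t ω} = ⋃ (r : ℕ × ℕ) (_ : s < (r.1 : ℝ≥0∞) / ((r.2 : ℝ≥0∞) + 1)),
      {ω | (r.1 : ℝ≥0∞) / ((r.2 : ℝ≥0∞) + 1) < t ω} := by
    ext ω
    simp only [Set.mem_ofPred_eq, Set.mem_iUnion, exists_prop, Prod.exists]
    constructor
    · exact exists_ratio_btwn
    · rintro ⟨a, b, h1, h2⟩
      exact h1.trans h2
  rw [this]
  exact isOpen_iUnion fun r => isOpen_iUnion fun _ =>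
    UniformlyEffectivelyOpen.isOpen (ι := ℕ × ℕ) h r

theorem AlgRand.LowerSemicomputable.lowerSemicontinuous {t : Cantor → ℝ≥0∞}
    (h : LowerSemicomputable t) : LowerSemicontinuous t :=
  lowerSemicontinuous_iff_isOpen_preimage.2 h.isOpen_lt

theorem AlgRand.LowerSemicomputable.measurable {t : Cantor → ℝ≥0∞}
    (h : LowerSemicomputable t) : Measurable t :=
  h.lowerSemicontinuous.measurable

/-! ### Measurable selectors of the relation -/

/-- A measurable selector of `F`: a measurable map whose graph is contained in `F`. -/
def IsSelector (F : Set (Cantor × Cantor)) (s : Cantor → Cantor) : Prop :=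
  Measurable s ∧ ∀ α, (α, s α) ∈ F

theorem relPreimage_univ {F : Set (Cantor × Cantor)} (hproj : ∀ α, ∃ β, (α, β) ∈ F) :
    relPreimage F Set.univ = Set.univ := by
  ext α
  obtain ⟨β, h⟩ := hproj α
  simp only [Set.mem_univ, iff_true]
  exact ⟨β, trivial, h⟩

theorem AlgRand.ComputableClopenPreimages.measurableSet {F : Set (Cantor × Cantor)}
    (hpre : ComputableClopenPreimages F) (y : List Bool) :
    MeasurableSet (relPreimage F (interval y)) := by
  obtain ⟨g, -, hg⟩ := hpre
  have : relPreimage F (interval y) = ⋃ x : {x // x ∈ g y}, interval x := by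
    rw [hg]
    ext ω
    simp
  rw [this]
  exact MeasurableSet.iUnion fun x => measurableSet_interval _

/-- A section that meets `[z]` meets `[z0]` or `[z1]`. -/
theorem relPreimage_interval_split {F : Set (Cantor × Cantor)} {α : Cantor} {z : List Bool}
    (h : α ∈ relPreimage F (interval z)) :
    α ∈ relPreimage F (interval (z ++ [false])) ∨ α ∈ relPreimage F (interval (z ++ [true])) := by
  obtain ⟨β, hβ, hF⟩ := h
  have key : β ∈ interval (z ++ [β z.length]) := by
    rw [mem_interval_iff] at hβ ⊢
    conv_rhs => rw [← hβ]
    simp [cantorPrefix, List.range_succ]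
  cases hb : β z.length with
  | false => exact Or.inl ⟨β, hb ▸ key, hF⟩
  | true => exact Or.inr ⟨β, hb ▸ key, hF⟩

/-- A point all of whose neighbourhoods meet the section of an effectively closed relation belongs
to the section. -/
theorem AlgRand.EffectivelyClosed.mem_of_forall_prefix {F : Set (Cantor × Cantor)}
    (hF : EffectivelyClosed F) {α β : Cantor}
    (h : ∀ n, ∃ m ≥ n, α ∈ relPreimage F (interval (cantorPrefix β m))) : (α, β) ∈ F := by
  obtain ⟨A, -, hA⟩ := hF
  by_contra hn
  have hn' : (α, β) ∈ Fᶜ := hn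
  rw [hA] at hn'
  obtain ⟨x, y, hxy, hα, hβ⟩ := hn'
  obtain ⟨m, hm, γ, hγ, hF⟩ := h y.length
  have : (α, γ) ∈ Fᶜ := by
    rw [hA]
    exact ⟨x, y, hxy, hα, interval_anti (prefix_cantorPrefix_iff.2 ⟨hm, hβ⟩) hγ⟩
  exact this hF

open Classical in
/-- The `n`-th stage of the greedy search for the leftmost point of the section of `F` at `α`,
starting from the string `z`. -/
noncomputable def greedyString (F : Set (Cantor × Cantor)) (α : Cantor) (z : List Bool) :
    ℕ → List Bool
  | 0 => z
  | n + 1 =>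
    if α ∈ relPreimage F (interval (greedyString F α z n ++ [false])) then
      greedyString F α z n ++ [false]
    else greedyString F α z n ++ [true]

theorem length_greedyString (F : Set (Cantor × Cantor)) (α : Cantor) (z : List Bool) (n : ℕ) :
    (greedyString F α z n).length = z.length + n := by
  induction n with
  | zero => rfl
  | succ n ih => rw [greedyString]; split_ifs <;> simp [ih, add_assoc]

theorem greedyString_prefix (F : Set (Cantor × Cantor)) (α : Cantor) (z : List Bool) {m n : ℕ}
    (h : m ≤ n) : greedyString F α z m <+: greedyString F α z n := by
  induction n, h using Nat.le_induction with
  | base => exact List.prefix_rfl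
  | succ n _ ih =>
    refine ih.trans ?_
    rw [greedyString]
    split_ifs <;> exact List.prefix_append _ _

theorem mem_relPreimage_greedyString {F : Set (Cantor × Cantor)} {α : Cantor} {z : List Bool}
    (h : α ∈ relPreimage F (interval z)) (n : ℕ) :
    α ∈ relPreimage F (interval (greedyString F α z n)) := by
  induction n with
  | zero => exact h
  | succ n ih =>
    rw [greedyString]
    split_ifs with h'
    · exact h'
    · exact (relPreimage_interval_split ih).resolve_left h'

/-- The infinite sequence found by the greedy search. -/
noncomputable def greedyPath (F : Set (Cantor × Cantor)) (α : Cantor) (z : List Bool) : Cantor :=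
  fun i => (greedyString F α z (i + 1)).getD i false

theorem greedyPath_mem_interval (F : Set (Cantor × Cantor)) (α : Cantor) (z : List Bool) (n : ℕ) :
    greedyPath F α z ∈ interval (greedyString F α z n) := by
  intro i
  have hi : (i : ℕ) < (greedyString F α z (i + 1)).length := by
    simp only [length_greedyString]; omega
  rw [greedyPath, List.getD_eq_getElem _ _ hi, List.get_eq_getElem]
  rcases le_total ((i : ℕ) + 1) n with h | h
  · exact (greedyString_prefix F α z h).getElem hi
  · exact ((greedyString_prefix F α z h).getElem i.2).symm

theorem measurable_greedyPath {F : Set (Cantor × Cantor)} (hpre : ComputableClopenPreimages F)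
    (z : List Bool) : Measurable fun α => greedyPath F α z := by
  classical
  let _ : MeasurableSpace (List Bool) := ⊤
  have hs : ∀ n, Measurable fun α => greedyString F α z n := by
    intro n
    induction n with
    | zero => exact measurable_const
    | succ n ih =>
      have hstep : Measurable fun p : List Bool × Cantor =>
          if p.2 ∈ relPreimage F (interval (p.1 ++ [false])) then p.1 ++ [false]
          else p.1 ++ [true] :=
        measurable_from_prod_countable_right fun x =>
          Measurable.ite (hpre.measurableSet (x ++ [false]))
            (measurable_const (a := x ++ [false])) (measurable_const (a := x ++ [true]))
      exact hstep.comp (ih.prodMk measurable_id)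
  refine measurable_pi_iff.2 fun i => ?_
  exact (measurable_from_top (f := fun l : List Bool => l.getD i false)).comp (hs (i + 1))

/-- For every string `y` there is a measurable selector whose value lies in `[y]` whenever the
section allows this. -/
theorem exists_selector {F : Set (Cantor × Cantor)} (hF : EffectivelyClosed F)
    (hproj : ∀ α, ∃ β, (α, β) ∈ F) (hpre : ComputableClopenPreimages F) (y : List Bool) :
    ∃ s, IsSelector F s ∧ ∀ α ∈ relPreimage F (interval y), s α ∈ interval y := by
  classical
  have key : ∀ α z, α ∈ relPreimage F (interval z) → (α, greedyPath F α z) ∈ F := by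
    intro α z h
    refine hF.mem_of_forall_prefix fun n => ⟨z.length + n, by omega, ?_⟩
    have := mem_interval_iff.1 (greedyPath_mem_interval F α z n)
    rw [length_greedyString] at this
    rw [this]
    exact mem_relPreimage_greedyString h n
  refine ⟨fun α => if α ∈ relPreimage F (interval y) then greedyPath F α y
    else greedyPath F α [], ⟨Measurable.ite (hpre.measurableSet y) (measurable_greedyPath hpre y)
      (measurable_greedyPath hpre []), fun α => ?_⟩, fun α hα => ?_⟩
  · dsimp only
    split_ifs with h
    · exact key _ _ h
    · refine key _ _ ?_
      rw [interval_nil, relPreimage_univ hproj]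
      trivial
  · simp only [if_pos hα]
    exact greedyPath_mem_interval F α y 0

/-- The image of `P` under a selector is couplable with `P`. -/
theorem IsSelector.map_mem_couplable {F : Set (Cantor × Cantor)} {s : Cantor → Cantor}
    (hs : IsSelector F s) (hFm : MeasurableSet F) (P : Distribution) :
    P.map hs.1.aemeasurable ∈ couplable F P := by
  have hm : Measurable fun α => (α, s α) := measurable_id.prodMk hs.1
  refine ⟨P.map hm.aemeasurable, ?_, ?_, ?_⟩
  · rw [ProbabilityMeasure.toMeasure_map, Measure.map_apply hm hFm.compl]
    have : (fun α => (α, s α)) ⁻¹' Fᶜ = ∅ := by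
      ext α
      simpa using hs.2 α
    rw [this, measure_empty]
  · rw [ProbabilityMeasure.toMeasure_map, Measure.map_map measurable_fst hm]
    exact Measure.map_id
  · rw [ProbabilityMeasure.toMeasure_map, Measure.map_map measurable_snd hm]
    rfl

theorem AlgRand.EffectivelyClosed.measurableSet {F : Set (Cantor × Cantor)}
    (hF : EffectivelyClosed F) : MeasurableSet F := by
  obtain ⟨A, -, hA⟩ := hF
  rw [← MeasurableSet.compl_iff, hA]
  have : {p : Cantor × Cantor | ∃ x y, A (x, y) ∧ p.1 ∈ interval x ∧ p.2 ∈ interval y} =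
      ⋃ q : {q // A q}, interval q.1.1 ×ˢ interval q.1.2 := by
    ext p
    simp only [Set.mem_ofPred_eq, Set.mem_iUnion, Subtype.exists, Prod.exists, Set.mem_prod,
      exists_prop]
  rw [this]
  exact MeasurableSet.iUnion fun q => (measurableSet_interval _).prod (measurableSet_interval _)

/-- Of two selectors one can choose, point by point, the one with the larger value of `t`. -/
theorem IsSelector.exists_max {F : Set (Cantor × Cantor)} {s₁ s₂ : Cantor → Cantor}
    (h₁ : IsSelector F s₁) (h₂ : IsSelector F s₂) {t : Cantor → ℝ≥0∞} (ht : Measurable t) :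
    ∃ s, IsSelector F s ∧ ∀ α, t (s α) = max (t (s₁ α)) (t (s₂ α)) := by
  classical
  refine ⟨fun α => if t (s₁ α) ≤ t (s₂ α) then s₂ α else s₁ α,
    ⟨Measurable.ite (measurableSet_le (ht.comp h₁.1) (ht.comp h₂.1)) h₂.1 h₁.1, fun α => ?_⟩,
    fun α => ?_⟩
  · dsimp only
    split_ifs
    exacts [h₂.2 α, h₁.2 α]
  · dsimp only
    split_ifs with h
    · exact (max_eq_right h).symm
    · exact (max_eq_left (not_le.1 h).le).symm

/-- The supremum of a lower semicontinuous function over the sections of `F` has `P`-integral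
bounded by the integrals of the function over the distributions couplable with `P`. The supremum is
approached along maxima of finitely many selectors, each of which is again a selector and yields a
distribution couplable with `P`. -/
theorem lintegral_iSup_section_le {F : Set (Cantor × Cantor)} (hF : EffectivelyClosed F)
    (hproj : ∀ α, ∃ β, (α, β) ∈ F) (hpre : ComputableClopenPreimages F) (P : Distribution)
    {t : Cantor → ℝ≥0∞} (htm : Measurable t)
    (hopen : ∀ s β, s < t β → ∃ y, β ∈ interval y ∧ ∀ γ ∈ interval y, s < t γ) {c : ℝ≥0∞}
    (hc : ∀ Q ∈ couplable F P, ∫⁻ β, t β ∂(Q : Measure Cantor) ≤ c) :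
    ∫⁻ α, ⨆ β ∈ {β | (α, β) ∈ F}, t β ∂(P : Measure Cantor) ≤ c := by
  obtain ⟨e, he⟩ := exists_surjective_nat (List Bool)
  choose σ hσ hσy using exists_selector hF hproj hpre
  have hex : ∀ n : ℕ, ∃ s, IsSelector F s ∧
      ∀ α, t (s α) = partialSups (fun n α => t (σ (e n) α)) n α := by
    intro n
    induction n with
    | zero => exact ⟨_, hσ (e 0), fun α => by simp⟩
    | succ n ih =>
      obtain ⟨s, hs, h⟩ := ih
      obtain ⟨s', hs', h'⟩ := hs.exists_max (hσ (e (n + 1))) htm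
      refine ⟨s', hs', fun α => ?_⟩
      rw [h', h, ← Order.succ_eq_add_one, partialSups_succ]
      rfl
  choose s hs hts using hex
  have hle : ∀ α, ⨆ β ∈ {β | (α, β) ∈ F}, t β ≤ ⨆ n, t (s n α) := by
    intro α
    refine iSup₂_le fun β hβ => le_of_forall_lt fun r hr => ?_
    obtain ⟨y, hy, hyt⟩ := hopen r β hr
    obtain ⟨n, rfl⟩ := he y
    have h1 : r < t (σ (e n) α) := hyt _ (hσy (e n) α ⟨β, hy, hβ⟩)
    refine h1.trans_le (le_iSup_of_le n ?_)
    rw [hts]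
    exact le_partialSups (fun n α => t (σ (e n) α)) n α
  refine (lintegral_mono hle).trans ?_
  rw [lintegral_iSup (f := fun n α => t (s n α)) (fun n => htm.comp (hs n).1)]
  · refine iSup_le fun n => ?_
    have := hc _ ((hs n).map_mem_couplable hF.measurableSet P)
    rwa [ProbabilityMeasure.toMeasure_map, lintegral_map htm (hs n).1] at this
  · intro m n hmn α
    dsimp only
    rw [hts, hts]
    have h := (partialSups fun n α => t (σ (e n) α)).monotone hmn
    exact h α

/-! ### Moving tests from the class of couplable distributions to `P` -/

/-- The supremum of `t` over the section of `F` at a first coordinate. -/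
noncomputable def supSection (F : Set (Cantor × Cantor)) (t : Cantor → ℝ≥0∞) (α : Cantor) :
    ℝ≥0∞ :=
  ⨆ β ∈ {β | (α, β) ∈ F}, t β

theorem AlgRand.UniformlyEffectivelyOpen.relPreimage {ι : Type} [Primcodable ι]
    {U : ι → Set Cantor} (hU : UniformlyEffectivelyOpen U) {F : Set (Cantor × Cantor)}
    (hpre : ComputableClopenPreimages F) :
    UniformlyEffectivelyOpen fun i => AlgRand.relPreimage F (U i) := by
  obtain ⟨A, hA, hU⟩ := hU
  obtain ⟨g, hg, hgF⟩ := hpre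
  have hre : REPred fun p : (ι × List Bool) × List Bool => A (p.1.1, p.2) ∧ p.1.2 ∈ g p.2 :=
    (hA.comp' ((Computable.fst.comp Computable.fst).pair Computable.snd)).and'
      (rePred_mem_list (hg.comp Computable.snd) (Computable.snd.comp Computable.fst))
  refine uniformlyEffectivelyOpen_of_re hre fun i => ?_
  ext α
  constructor
  · rintro ⟨β, hβ, hF⟩
    rw [hU] at hβ
    obtain ⟨y, hy, hβy⟩ := hβ
    have : α ∈ AlgRand.relPreimage F (interval y) := ⟨β, hβy, hF⟩
    rw [hgF] at this
    obtain ⟨x, hx, hα⟩ := this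
    exact ⟨x, y, ⟨hy, hx⟩, hα⟩
  · rintro ⟨x, y, ⟨hy, hx⟩, hα⟩
    have : α ∈ AlgRand.relPreimage F (interval y) := by
      rw [hgF]
      exact ⟨x, hx, hα⟩
    obtain ⟨β, hβ, hF⟩ := this
    refine ⟨β, ?_, hF⟩
    rw [hU]
    exact ⟨y, hy, hβ⟩

theorem AlgRand.UniformlyEffectivelyOpen.exists_interval_subset {ι : Type} [Primcodable ι]
    {U : ι → Set Cantor} (hU : UniformlyEffectivelyOpen U) {i : ι} {β : Cantor} (hβ : β ∈ U i) :
    ∃ y, β ∈ interval y ∧ interval y ⊆ U i := by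
  obtain ⟨A, -, hA⟩ := hU
  rw [hA] at hβ
  obtain ⟨y, hy, h⟩ := hβ
  refine ⟨y, h, fun γ hγ => ?_⟩
  rw [hA]
  exact ⟨y, hy, hγ⟩

theorem isExpTest_supSection {P : Distribution} {F : Set (Cantor × Cantor)}
    (hF : EffectivelyClosed F) (hproj : ∀ α, ∃ β, (α, β) ∈ F)
    (hpre : ComputableClopenPreimages F) {t : Cantor → ℝ≥0∞}
    (ht : IsExpTest (couplable F P) t) : IsExpTest {P} (supSection F t) := by
  have hl : UniformlyEffectivelyOpen fun r : ℕ × ℕ =>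
    {ω | (r.1 : ℝ≥0∞) / ((r.2 : ℝ≥0∞) + 1) < t ω} := ht.1
  refine ⟨?_, ?_⟩
  · have h := hl.relPreimage hpre
    unfold LowerSemicomputable
    convert h using 3 with r
    ext α
    simp only [supSection, lt_iSup_iff, Set.mem_ofPred_eq, relPreimage, exists_prop]
    exact exists_congr fun _ => and_comm
  · rintro Q rfl
    refine lintegral_iSup_section_le hF hproj hpre Q ht.1.measurable ?_ ht.2
    intro s β hs
    obtain ⟨a, b, h1, h2⟩ := exists_ratio_btwn hs
    obtain ⟨y, hy, hsub⟩ := hl.exists_interval_subset (i := (a, b)) h2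
    exact ⟨y, hy, fun γ hγ => h1.trans (hsub hγ)⟩

theorem isMLTest_relPreimage {P : Distribution} {F : Set (Cantor × Cantor)}
    (hF : EffectivelyClosed F) (hproj : ∀ α, ∃ β, (α, β) ∈ F)
    (hpre : ComputableClopenPreimages F) {U : ℕ → Set Cantor}
    (hU : IsMLTest (couplable F P) U) : IsMLTest {P} fun i => relPreimage F (U i) := by
  classical
  refine ⟨fun i j hij => ?_, hU.2.1.relPreimage hpre, ?_⟩
  · rintro α ⟨β, hβ, h⟩
    exact ⟨β, hU.1 hij hβ, h⟩
  · rintro Q rfl i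
    have hm := hU.2.1.measurableSet i
    have := lintegral_iSup_section_le hF hproj hpre Q (t := (U i).indicator 1)
      (c := 2⁻¹ ^ i) (measurable_one.indicator hm) ?_ ?_
    · rw [← lintegral_indicator_one ((hU.2.1.relPreimage hpre).measurableSet i)]
      refine (lintegral_mono fun α => ?_).trans this
      by_cases hα : α ∈ relPreimage F (U i)
      · obtain ⟨β, hβ, h⟩ := hα
        refine (Set.indicator_le_self' (by simp) α).trans ?_
        refine le_iSup₂_of_le β h ?_
        simp [hβ]
      · simp [hα]
    · intro s β hs
      have hβ : β ∈ U i := by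
        by_contra hn
        simp [hn] at hs
      obtain ⟨y, hy, hsub⟩ := hU.2.1.exists_interval_subset hβ
      refine ⟨y, hy, fun γ hγ => ?_⟩
      simpa [hsub hγ, hβ] using hs
    · intro Q hQ
      rw [lintegral_indicator_one hm]
      exact hU.2.2 Q hQ i

/-! ### Moving tests from `P` to the class of couplable distributions -/

/-- The infimum of `t` over the section of `F` at a second coordinate. -/
noncomputable def infSection (F : Set (Cantor × Cantor)) (t : Cantor → ℝ≥0∞) (β : Cantor) :
    ℝ≥0∞ :=
  ⨅ α ∈ {α | (α, β) ∈ F}, t α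

/-- The points whose whole section is contained in `U`. -/
def relCore (F : Set (Cantor × Cantor)) (U : Set Cantor) : Set Cantor :=
  {β | ∀ α, (α, β) ∈ F → α ∈ U}

/-- All strings of a given length. -/
def stringsOfLength : ℕ → List (List Bool)
  | 0 => [[]]
  | n + 1 => (stringsOfLength n).map (List.cons false) ++ (stringsOfLength n).map (List.cons true)

theorem mem_stringsOfLength {n : ℕ} {u : List Bool} : u ∈ stringsOfLength n ↔ u.length = n := by
  induction n generalizing u with
  | zero => simp [stringsOfLength]
  | succ n ih =>
    cases u with
    | nil => simp [stringsOfLength]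
    | cons b u => cases b <;> simp [stringsOfLength, ih]

theorem primrec_stringsOfLength : Primrec stringsOfLength := by
  have hm : ∀ b : Bool, Primrec fun p : ℕ × List (List Bool) => p.2.map (List.cons b) := fun b =>
    Primrec.list_map Primrec.snd (Primrec.list_cons.comp (Primrec.const b) Primrec.snd)
  have hs : Primrec₂ fun (_ : ℕ) (L : List (List Bool)) =>
      L.map (List.cons false) ++ L.map (List.cons true) :=
    Primrec.list_append.comp (hm false) (hm true)
  refine (Primrec.nat_rec₁ [[]] hs).of_eq fun n => ?_
  induction n with
  | zero => rfl
  | succ n ih => simp only [stringsOfLength, ← ih]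

/-- The section at `β` is contained in `U i` if and only if the intervals enumerated for `U i` and
those rectangles enumerated for the complement of `F` whose second side contains `β` cover the whole
space. By compactness the cover can be verified on the strings of some finite length, which makes the
condition enumerable. -/
theorem AlgRand.UniformlyEffectivelyOpen.relCore {ι : Type} [Primcodable ι] {U : ι → Set Cantor}
    (hU : UniformlyEffectivelyOpen U) {F : Set (Cantor × Cantor)} (hF : EffectivelyClosed F) :
    UniformlyEffectivelyOpen fun i => _root_.relCore F (U i) := by
  obtain ⟨A, hA, hU⟩ := hU
  obtain ⟨B, hB, hF⟩ := hF
  let G : ι × List Bool → Prop := fun p => ∃ x, A (p.1, x) ∧ x <+: p.2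
  let H : List Bool × List Bool → Prop := fun p =>
    ∃ q : List Bool × List Bool, B q ∧ q.1 <+: p.1 ∧ q.2 <+: p.2
  have hG : REPred G := by
    refine REPred.exists' (p := fun r : (ι × List Bool) × List Bool =>
      A (r.1.1, r.2) ∧ r.2 <+: r.1.2) ?_
    exact (hA.comp' ((Computable.fst.comp Computable.fst).pair Computable.snd)).and'
      (rePred_prefix Computable.snd (Computable.snd.comp Computable.fst))
  have hH : REPred H := by
    refine REPred.exists' (p := fun r : (List Bool × List Bool) × (List Bool × List Bool) =>
      B r.2 ∧ r.2.1 <+: r.1.1 ∧ r.2.2 <+: r.1.2) ?_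
    exact (hB.comp' Computable.snd).and'
      ((rePred_prefix (Computable.fst.comp Computable.snd) (Computable.fst.comp Computable.fst)).and'
      (rePred_prefix (Computable.snd.comp Computable.snd) (Computable.snd.comp Computable.fst)))
  have hre : REPred fun p : ι × List Bool =>
      ∀ u ∈ stringsOfLength p.2.length, G (p.1, u) ∨ H (u, p.2) := by
    refine REPred.forall_mem_list (p := fun r : (ι × List Bool) × List Bool =>
      G (r.1.1, r.2) ∨ H (r.2, r.1.2)) ?_
      (primrec_stringsOfLength.to_comp.comp (Computable.list_length.comp Computable.snd))
    exact (hG.comp' ((Computable.fst.comp Computable.fst).pair Computable.snd)).or'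
      (hH.comp' (Computable.snd.pair (Computable.snd.comp Computable.fst)))
  refine ⟨_, hre, fun i => ?_⟩
  ext β
  constructor
  · intro hβ
    -- The points accounted for at level `n`: an increasing open cover of the Cantor space.
    let O : ℕ → Set Cantor := fun n =>
      {α | G (i, cantorPrefix α n) ∨ H (cantorPrefix α n, cantorPrefix β n)}
    have hOo : ∀ n, IsOpen (O n) := by
      intro n
      rw [isOpen_iff_forall_mem_open]
      intro α hα
      refine ⟨interval (cantorPrefix α n), fun γ hγ => ?_, (isClopen_interval _).isOpen,
        mem_interval_cantorPrefix α n⟩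
      have : cantorPrefix γ n = cantorPrefix α n := by simpa using mem_interval_iff.1 hγ
      simpa only [O, Set.mem_ofPred_eq, this] using hα
    have hOm : Monotone O := by
      rintro m n hmn α (⟨x, hx, hxα⟩ | ⟨q, hq, hq1, hq2⟩)
      · exact Or.inl ⟨x, hx, hxα.trans (cantorPrefix_prefix α hmn)⟩
      · exact Or.inr ⟨q, hq, hq1.trans (cantorPrefix_prefix α hmn),
          hq2.trans (cantorPrefix_prefix β hmn)⟩
    have hcov : (Set.univ : Set Cantor) ⊆ ⋃ n, O n := by
      intro α _
      rw [Set.mem_iUnion]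
      by_cases h : (α, β) ∈ F
      · have := hβ α h
        rw [hU] at this
        obtain ⟨x, hx, hα⟩ := this
        exact ⟨x.length, Or.inl ⟨x, hx, prefix_cantorPrefix_iff.2 ⟨le_rfl, hα⟩⟩⟩
      · have h' : (α, β) ∈ Fᶜ := h
        rw [hF] at h'
        obtain ⟨x, y, hxy, hα, hβ⟩ := h'
        exact ⟨max x.length y.length, Or.inr ⟨(x, y), hxy,
          prefix_cantorPrefix_iff.2 ⟨le_max_left _ _, hα⟩,
          prefix_cantorPrefix_iff.2 ⟨le_max_right _ _, hβ⟩⟩⟩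
    obtain ⟨n, hn⟩ := isCompact_univ.elim_directed_cover O hOo hcov hOm.directed_le
    refine ⟨cantorPrefix β n, fun u hu => ?_, mem_interval_cantorPrefix β n⟩
    rw [mem_stringsOfLength, length_cantorPrefix] at hu
    let α : Cantor := fun k => u.getD k false
    have hα : cantorPrefix α n = u := by
      refine List.ext_getElem (by simp [hu]) fun k h1 h2 => ?_
      simp [cantorPrefix, α, h2]
    have := hn (Set.mem_univ α)
    simpa only [O, Set.mem_ofPred_eq, hα] using this
  · rintro ⟨y, hy, hβ⟩ α hα
    have hu := hy (cantorPrefix α y.length) (mem_stringsOfLength.2 (by simp))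
    rcases hu with ⟨x, hx, hxα⟩ | ⟨q, hq, hq1, hq2⟩
    · rw [hU]
      exact ⟨x, hx, (prefix_cantorPrefix_iff.1 hxα).2⟩
    · have : (α, β) ∈ Fᶜ := by
        rw [hF]
        exact ⟨q.1, q.2, hq, (prefix_cantorPrefix_iff.1 hq1).2, interval_anti hq2 hβ⟩
      exact absurd hα this

theorem AlgRand.EffectivelyClosed.isClosed_section {F : Set (Cantor × Cantor)}
    (hF : EffectivelyClosed F) (β : Cantor) : IsClosed {α | (α, β) ∈ F} := by
  obtain ⟨A, -, hA⟩ := hF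
  rw [← isOpen_compl_iff, isOpen_iff_forall_mem_open]
  intro α hα
  have hα' : (α, β) ∈ Fᶜ := hα
  rw [hA] at hα'
  obtain ⟨x, y, hxy, hx, hy⟩ := hα'
  refine ⟨interval x, fun γ hγ => ?_, (isClopen_interval x).isOpen, hx⟩
  have : (γ, β) ∈ Fᶜ := by
    rw [hA]
    exact ⟨x, y, hxy, hγ, hy⟩
  exact this

/-- On a nonempty section the infimum is attained. -/
theorem exists_eq_infSection {F : Set (Cantor × Cantor)} (hF : EffectivelyClosed F)
    {t : Cantor → ℝ≥0∞} (ht : LowerSemicomputable t) {β : Cantor}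
    (hne : {α | (α, β) ∈ F}.Nonempty) : ∃ α, (α, β) ∈ F ∧ t α = infSection F t β := by
  obtain ⟨α, hα, hmin⟩ := (ht.lowerSemicontinuous.lowerSemicontinuousOn _).exists_isMinOn hne
    (hF.isClosed_section β).isCompact
  exact ⟨α, hα, le_antisymm (le_iInf₂ fun γ hγ => hmin hγ) (iInf₂_le α hα)⟩

theorem infSection_eq_top {F : Set (Cantor × Cantor)} {t : Cantor → ℝ≥0∞} {β : Cantor}
    (hne : ¬ {α | (α, β) ∈ F}.Nonempty) : infSection F t β = ⊤ := by
  rw [Set.not_nonempty_iff_eq_empty] at hne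
  simp [infSection, hne]

theorem lowerSemicomputable_infSection {F : Set (Cantor × Cantor)} (hF : EffectivelyClosed F)
    {t : Cantor → ℝ≥0∞} (ht : LowerSemicomputable t) :
    LowerSemicomputable (infSection F t) := by
  have hl : UniformlyEffectivelyOpen fun r : ℕ × ℕ =>
    {ω | (r.1 : ℝ≥0∞) / ((r.2 : ℝ≥0∞) + 1) < t ω} := ht
  have h := hl.relCore hF
  unfold LowerSemicomputable
  convert h using 3 with r
  ext β
  simp only [Set.mem_ofPred_eq, relCore]
  constructor
  · intro h α hα
    exact h.trans_le (iInf₂_le α hα)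
  · intro h
    by_cases hne : {α | (α, β) ∈ F}.Nonempty
    · obtain ⟨α, hα, he⟩ := exists_eq_infSection hF ht hne
      rw [← he]
      exact h α hα
    · rw [infSection_eq_top hne]
      exact ENNReal.div_lt_top (by simp) (by simp)

theorem isExpTest_infSection {P : Distribution} {F : Set (Cantor × Cantor)}
    (hF : EffectivelyClosed F) {t : Cantor → ℝ≥0∞}
    (ht : IsExpTest {P} t) : IsExpTest (couplable F P) (infSection F t) := by
  have hl := lowerSemicomputable_infSection hF ht.1
  refine ⟨hl, ?_⟩
  rintro Q ⟨S, hS, h1, h2⟩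
  rw [← h2, lintegral_map hl.measurable measurable_snd]
  calc ∫⁻ p, infSection F t p.2 ∂(S : Measure (Cantor × Cantor))
      ≤ ∫⁻ p, t p.1 ∂(S : Measure (Cantor × Cantor)) := by
        refine lintegral_mono_ae ?_
        filter_upwards [mem_ae_iff.2 hS] with p hp
        exact iInf₂_le p.1 hp
    _ = ∫⁻ α, t α ∂(P : Measure Cantor) := by
        rw [← h1, lintegral_map ht.1.measurable measurable_fst]
    _ ≤ 1 := ht.2 P rfl

theorem isMLTest_relCore {P : Distribution} {F : Set (Cantor × Cantor)}
    (hF : EffectivelyClosed F) {U : ℕ → Set Cantor}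
    (hU : IsMLTest {P} U) : IsMLTest (couplable F P) fun i => relCore F (U i) := by
  refine ⟨fun i j hij β hβ α hα => hU.1 hij (hβ α hα), hU.2.1.relCore hF, ?_⟩
  rintro Q ⟨S, hS, h1, h2⟩ i
  rw [← h2, Measure.map_apply measurable_snd ((hU.2.1.relCore hF).measurableSet i)]
  calc (S : Measure (Cantor × Cantor)) (Prod.snd ⁻¹' relCore F (U i))
      ≤ (S : Measure (Cantor × Cantor)) (Prod.fst ⁻¹' U i) := by
        refine measure_mono_ae ?_
        filter_upwards [mem_ae_iff.2 hS] with p hp h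
        exact h p.1 hp
    _ = (P : Measure Cantor) (U i) := by
        rw [← h1, Measure.map_apply measurable_fst (hU.2.1.measurableSet i)]
    _ ≤ 2⁻¹ ^ i := hU.2.2 P rfl i

/-! ### A universal enumeration of sets of bounded weight -/

section Trimming

variable {ι β : Type} [Primcodable ι] [Primcodable β]

/-- The element `(i, b)` is accepted by the program with number `e` within `s` steps. -/
def AcceptsWithin (e : ℕ) (c : ι × β) (s : ℕ) : Prop :=
  ((Denumerable.ofNat Nat.Partrec.Code e).evaln s (Encodable.encode c)).isSome

theorem AcceptsWithin.mono {e : ℕ} {c : ι × β} {s s' : ℕ} (h : AcceptsWithin e c s)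
    (hs : s ≤ s') : AcceptsWithin e c s' := by
  obtain ⟨v, hv⟩ := Option.isSome_iff_exists.1 h
  exact Option.isSome_iff_exists.2 ⟨v, Nat.Partrec.Code.evaln_mono hs hv⟩

theorem computablePred_acceptsWithin {α : Type} [Primcodable α] {e s : α → ℕ} {c : α → ι × β}
    (he : Computable e) (hc : Computable c) (hs : Computable s) :
    ComputablePred fun a => AcceptsWithin (e a) (c a) (s a) :=
  computablePred_evaln_isSome ((Computable.ofNat Nat.Partrec.Code).comp he) hs
    (Computable.encode.comp hc)

open Classical in
/-- The contribution of the element with code `j` to the total weight of the elements accepted within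
`s` steps. -/
noncomputable def acceptedWeight {M : Type*} [Zero M] (v : ι × β → M) (e : ℕ) (i : ι) (s j : ℕ) :
    M :=
  ((Encodable.decode₂ β j).map fun b =>
    if AcceptsWithin e (i, b) s then v (i, b) else 0).getD 0

theorem acceptedWeight_encode {M : Type*} [Zero M] {v : ι × β → M} {e : ℕ} {i : ι} {s : ℕ} {b : β}
    (h : AcceptsWithin e (i, b) s) : acceptedWeight v e i s (Encodable.encode b) = v (i, b) := by
  simp [acceptedWeight, h]

theorem acceptedWeight_ne_zero {M : Type*} [Zero M] {v : ι × β → M} {e : ℕ} {i : ι} {s j : ℕ}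
    (h : acceptedWeight v e i s j ≠ 0) :
    ∃ b : β, Encodable.encode b = j ∧ AcceptsWithin e (i, b) s := by
  unfold acceptedWeight at h
  cases hd : Encodable.decode₂ β j with
  | none => simp [hd] at h
  | some b =>
    refine ⟨b, Encodable.decode₂_eq_some.1 hd, ?_⟩
    by_contra hn
    simp [hd, hn] at h

/-- The total weight, with the weights replaced by their `m`-th approximations, of what the program
`e` accepts within `s` steps. -/
noncomputable def acceptedCost (w : ι × β → ℕ → ℕ) (e : ℕ) (i : ι) (s m : ℕ) : ℕ :=
  ∑ j ∈ Finset.range s, acceptedWeight (fun c => w c m) e i s j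

theorem computable_acceptedCost {w : ι × β → ℕ → ℕ} (hw : Computable₂ w) :
    Computable fun p : (ℕ × ι) × (ℕ × ℕ) => acceptedCost w p.1.1 p.1.2 p.2.1 p.2.2 := by
  classical
  unfold acceptedCost acceptedWeight
  refine Computable.sum_range (α := (ℕ × ι) × (ℕ × ℕ)) ?_ (Computable.fst.comp Computable.snd)
  refine Computable.option_getD (Computable.option_map
    (Primrec.decode₂.to_comp.comp Computable.snd) ?_) (Computable.const 0)
  have hib : Computable fun q : (((ℕ × ι) × (ℕ × ℕ)) × ℕ) × β => (q.1.1.1.2, q.2) :=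
    (Computable.snd.comp (Computable.fst.comp (Computable.fst.comp Computable.fst))).pair
      Computable.snd
  refine Computable.ite' (α := (((ℕ × ι) × (ℕ × ℕ)) × ℕ) × β) (computablePred_acceptsWithin
      (Computable.fst.comp (Computable.fst.comp (Computable.fst.comp Computable.fst))) hib
      (Computable.fst.comp (Computable.snd.comp (Computable.fst.comp Computable.fst))))
    (hw.comp hib (Computable.snd.comp (Computable.snd.comp (Computable.fst.comp Computable.fst))))
    (Computable.const 0)

/-- The `e`-th enumerable family of sets, trimmed: the elements found by stage `s` are released only
when the approximations show that their total weight is below `B + 1`. -/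
def TrimmedMem (w : ι × β → ℕ → ℕ) (B : ℕ) (p : (ℕ × ι) × β) : Prop :=
  ∃ q : ℕ × ℕ, (Encodable.encode p.2 < q.1 ∧ AcceptsWithin p.1.1 (p.1.2, p.2) q.1) ∧
    acceptedCost w p.1.1 p.1.2 q.1 q.2 < (B + 1) * 2 ^ q.2

theorem rePred_trimmedMem {w : ι × β → ℕ → ℕ} (hw : Computable₂ w) (B : ℕ) :
    REPred (TrimmedMem w B) := by
  refine ComputablePred.re_exists (p := fun r : ((ℕ × ι) × β) × (ℕ × ℕ) =>
    (Encodable.encode r.1.2 < r.2.1 ∧ AcceptsWithin r.1.1.1 (r.1.1.2, r.1.2) r.2.1) ∧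
    acceptedCost w r.1.1.1 r.1.1.2 r.2.1 r.2.2 < (B + 1) * 2 ^ r.2.2) ?_
  have h1 : Computable fun r : ((ℕ × ι) × β) × (ℕ × ℕ) => r.1.1 :=
    Computable.fst.comp Computable.fst
  have hs : Computable fun r : ((ℕ × ι) × β) × (ℕ × ℕ) => r.2.1 :=
    Computable.fst.comp Computable.snd
  have hb : Computable fun r : ((ℕ × ι) × β) × (ℕ × ℕ) => r.1.2 :=
    Computable.snd.comp Computable.fst
  have hcost : Computable fun r : ((ℕ × ι) × β) × (ℕ × ℕ) =>
      acceptedCost w r.1.1.1 r.1.1.2 r.2.1 r.2.2 :=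
    Computable.comp (f := fun p : (ℕ × ι) × (ℕ × ℕ) => acceptedCost w p.1.1 p.1.2 p.2.1 p.2.2)
      (g := fun r : ((ℕ × ι) × β) × (ℕ × ℕ) => (r.1.1, r.2)) (computable_acceptedCost hw)
      (h1.pair Computable.snd)
  have hbound : Computable fun r : ((ℕ × ι) × β) × (ℕ × ℕ) => (B + 1) * 2 ^ r.2.2 :=
    Primrec.nat_mul.to_comp.comp (Computable.const (B + 1))
      (Computable.two_pow (Computable.snd.comp Computable.snd))
  exact ((ComputablePred.lt_comp (Computable.encode.comp hb) hs).and'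
    (computablePred_acceptsWithin (Computable.fst.comp h1) ((Computable.snd.comp h1).pair hb)
      hs)).and' (ComputablePred.lt_comp hcost hbound)

/-- Trimmed families have bounded weight: finitely many released elements are all present at the
latest of their stages, and the weight of that stage has been checked. -/
theorem tsum_trimmedMem_le {W : ι × β → ℝ≥0∞} {w : ι × β → ℕ → ℕ}
    (hle : ∀ c m, W c ≤ (w c m : ℝ≥0∞) / 2 ^ m) (B e : ℕ) (i : ι) :
    ∑' b, {b | TrimmedMem w B ((e, i), b)}.indicator (fun b => W (i, b)) b ≤ B + 1 := by
  classical
  rw [← tsum_subtype {b | TrimmedMem w B ((e, i), b)} fun b => W (i, b), ENNReal.tsum_eq_iSup_sum]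
  refine iSup_le fun S => ?_
  rcases S.eq_empty_or_nonempty with rfl | hne
  · simp
  have hT : ∀ b : {b | TrimmedMem w B ((e, i), b)}, ∃ q : ℕ × ℕ,
      (Encodable.encode b.1 < q.1 ∧ AcceptsWithin e (i, b.1) q.1) ∧
      acceptedCost w e i q.1 q.2 < (B + 1) * 2 ^ q.2 := fun b => b.2
  choose q hq hcost using hT
  obtain ⟨b₀, -, hmax⟩ := S.exists_max_image (fun b => (q b).1) hne
  set s := (q b₀).1
  set m := (q b₀).2
  have hsum : ∑ b ∈ S, w (i, b.1) m ≤ acceptedCost w e i s m := by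
    have hacc : ∀ b ∈ S, AcceptsWithin e (i, b.1) s := fun b hb => (hq b).2.mono (hmax b hb)
    have hinj : Set.InjOn (fun b : {b | TrimmedMem w B ((e, i), b)} => Encodable.encode b.1)
        (S : Set _) := fun a _ b _ h => Subtype.ext (Encodable.encode_injective h)
    calc ∑ b ∈ S, w (i, b.1) m
        = ∑ b ∈ S, acceptedWeight (fun c => w c m) e i s (Encodable.encode b.1) :=
          Finset.sum_congr rfl fun b hb =>
            (acceptedWeight_encode (v := fun c => w c m) (hacc b hb)).symm
      _ = ∑ j ∈ S.image fun b => Encodable.encode b.1,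
            acceptedWeight (fun c => w c m) e i s j := (Finset.sum_image hinj).symm
      _ ≤ _ := by
          refine Finset.sum_le_sum_of_subset fun j hj => ?_
          obtain ⟨b, hb, rfl⟩ := Finset.mem_image.1 hj
          exact Finset.mem_range.2 ((hq b).1.trans_le (hmax b hb))
  calc ∑ b ∈ S, W (i, b.1) ≤ ∑ b ∈ S, (w (i, b.1) m : ℝ≥0∞) / 2 ^ m :=
        Finset.sum_le_sum fun b _ => hle _ m
    _ = ((∑ b ∈ S, w (i, b.1) m : ℕ) : ℝ≥0∞) / 2 ^ m := by
        simp only [div_eq_mul_inv, ← Finset.sum_mul, Nat.cast_sum]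
    _ ≤ (((B + 1) * 2 ^ m : ℕ) : ℝ≥0∞) / 2 ^ m := by
        gcongr
        exact hsum.trans (hcost b₀).le
    _ = B + 1 := by
        push_cast
        exact ENNReal.mul_div_cancel_right (by simp) (by simp)

/-- Trimming does not affect a family whose sets have weight at most `B`. -/
theorem exists_trimmedMem_iff {W : ι × β → ℝ≥0∞} {w : ι × β → ℕ → ℕ}
    (hlim : ∀ c, Tendsto (fun m => (w c m : ℝ≥0∞) / 2 ^ m) atTop (𝓝 (W c))) {B : ℕ}
    {A : ι × β → Prop} (hA : REPred A)
    (hB : ∀ i, ∑' b, {b | A (i, b)}.indicator (fun b => W (i, b)) b ≤ B) :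
    ∃ e, ∀ i b, TrimmedMem w B ((e, i), b) ↔ A (i, b) := by
  classical
  obtain ⟨c, hc⟩ := REPred.exists_code hA
  have hacc : ∀ a : ι × β, A a ↔ ∃ s, AcceptsWithin (Encodable.encode c) a s := by
    intro a
    rw [hc]
    simp only [AcceptsWithin, Denumerable.ofNat_encode]
  refine ⟨Encodable.encode c, fun i b => ⟨?_, fun h => ?_⟩⟩
  · rintro ⟨q, ⟨-, h⟩, -⟩
    exact (hacc _).2 ⟨_, h⟩
  obtain ⟨n, hn⟩ := (hacc _).1 h
  set e := Encodable.encode c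
  -- At stage `s` the program has accepted `b`, and the approximated weights converge to weights
  -- with sum at most `B`, so that the check succeeds for some precision `m`.
  set s := max n (Encodable.encode b + 1)
  have hlimit : Tendsto (fun m => ((acceptedCost w e i s m : ℕ) : ℝ≥0∞) / 2 ^ m) atTop
      (𝓝 (∑ j ∈ Finset.range s, acceptedWeight W e i s j)) := by
    have : ∀ m, ((acceptedCost w e i s m : ℕ) : ℝ≥0∞) / 2 ^ m =
        ∑ j ∈ Finset.range s, acceptedWeight (fun c => (w c m : ℝ≥0∞) / 2 ^ m) e i s j := by
      intro m
      simp only [acceptedCost, Nat.cast_sum, div_eq_mul_inv, Finset.sum_mul]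
      refine Finset.sum_congr rfl fun j _ => ?_
      unfold acceptedWeight
      cases Encodable.decode₂ β j with
      | none => simp
      | some b =>
        simp only [Option.map_some, Option.getD_some]
        split_ifs <;> simp
    simp only [this]
    refine tendsto_finsetSum _ fun j _ => ?_
    unfold acceptedWeight
    cases Encodable.decode₂ β j with
    | none => simp
    | some b =>
      simp only [Option.map_some, Option.getD_some]
      split_ifs
      · exact hlim _
      · exact tendsto_const_nhds
  have hbound : ∑ j ∈ Finset.range s, acceptedWeight W e i s j < B + 1 := by
    calc ∑ j ∈ Finset.range s, acceptedWeight W e i s j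
        ≤ ∑' j, acceptedWeight W e i s j := ENNReal.sum_le_tsum _
      _ = ∑' b : β, acceptedWeight W e i s (Encodable.encode b) := by
          refine (Encodable.encode_injective.tsum_eq fun j hj => ?_).symm
          obtain ⟨b, hb, -⟩ := acceptedWeight_ne_zero hj
          exact ⟨b, hb⟩
      _ ≤ ∑' b, {b | A (i, b)}.indicator (fun b => W (i, b)) b := by
          refine ENNReal.tsum_le_tsum fun b => ?_
          by_cases hz : acceptedWeight W e i s (Encodable.encode b) = 0
          · rw [hz]
            exact zero_le
          obtain ⟨b', hb', hs⟩ := acceptedWeight_ne_zero hz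
          cases Encodable.encode_injective hb'
          rw [acceptedWeight_encode hs, Set.indicator_of_mem]
          exact (hacc _).2 ⟨s, hs⟩
      _ ≤ B := hB i
      _ < B + 1 := ENNReal.lt_add_right (by simp) (by simp)
  obtain ⟨m, hm⟩ := (hlimit.eventually_lt_const hbound).exists
  refine ⟨(s, m), ⟨by simp only [s]; omega, hn.mono (le_max_left _ _)⟩, ?_⟩
  rw [ENNReal.div_lt_iff (by simp) (by simp)] at hm
  exact_mod_cast hm

end Trimming

/-! ### Universal tests with respect to a computable distribution -/

/-- The probabilities of intervals are limits of computable upper bounds. -/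
theorem AlgRand.ComputableDistribution.exists_upper_approx {P : Distribution}
    (hP : ComputableDistribution P) :
    ∃ u : List Bool → ℕ → ℕ, Computable₂ u ∧
      (∀ x m, (P : Measure Cantor) (interval x) ≤ (u x m : ℝ≥0∞) / 2 ^ m) ∧
      ∀ x, Tendsto (fun m => (u x m : ℝ≥0∞) / 2 ^ m) atTop
        (𝓝 ((P : Measure Cantor) (interval x))) := by
  obtain ⟨f, hf, h⟩ := hP
  have hcast : ∀ x m, (((f x m + 1 : ℕ) : ℝ≥0∞)) / 2 ^ m =
      ENNReal.ofReal (((f x m : ℝ) + 1) / 2 ^ m) := by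
    intro x m
    rw [ENNReal.ofReal_div_of_pos (by positivity), ENNReal.ofReal_pow (by norm_num)]
    congr 1
    · rw [← Nat.cast_add_one, ENNReal.ofReal_natCast]
    · simp
  refine ⟨fun x m => f x m + 1, Computable.succ.comp hf, fun x m => ?_, fun x => ?_⟩
  · rw [hcast, ← ENNReal.ofReal_toReal (measure_ne_top (P : Measure Cantor) (interval x))]
    refine ENNReal.ofReal_le_ofReal ?_
    have := (abs_le.1 (h x m)).2
    rw [add_div]
    rw [Measure.real] at this
    linarith
  · simp only [hcast]
    rw [← ENNReal.ofReal_toReal (measure_ne_top (P : Measure Cantor) (interval x))]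
    refine ENNReal.tendsto_ofReal ?_
    have hz : Tendsto (fun m : ℕ => (1 : ℝ) / 2 ^ m) atTop (𝓝 0) := by
      simpa [one_div] using tendsto_pow_atTop_nhds_zero_of_lt_one
        (r := (2 : ℝ)⁻¹) (by norm_num) (by norm_num)
    have hlim : Tendsto (fun m : ℕ => (P : Measure Cantor).real (interval x) + 2 * (1 / 2 ^ m))
        atTop (𝓝 ((P : Measure Cantor).real (interval x))) := by
      simpa using tendsto_const_nhds.add (hz.const_mul 2)
    refine tendsto_of_tendsto_of_tendsto_of_le_of_le tendsto_const_nhds hlim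
      (fun m => ?_) (fun m => ?_)
    · have := (abs_le.1 (h x m)).2
      dsimp only
      rw [add_div]
      rw [Measure.real] at this
      linarith
    · have := (abs_le.1 (h x m)).1
      dsimp only
      rw [add_div]
      linarith

theorem tsum_indicator_interval_eq (μ : Measure Cantor) {V : Set Cantor} {A : List Bool → Prop}
    (hV : V = {ω | ∃ x, A x ∧ ω ∈ interval x})
    (hd : ∀ x y, A x → A y → x ≠ y → Disjoint (interval x) (interval y)) (c : ℝ≥0∞) :
    ∑' x, {x | A x}.indicator (fun x => c * μ (interval x)) x = c * μ V := by
  rw [measure_eq_tsum_interval μ hV hd, ← ENNReal.tsum_mul_left]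
  exact (tsum_subtype {x | A x} fun x => c * μ (interval x)).symm

/-- An element `c` that carries a string `x c` and a level `k c` gets the weight
`2 ^ k c * P [x c]`. There is an enumerable list of enumerable families whose sets have weight at
most `B + 1`, and it contains all enumerable families whose sets have weight at most `B`. -/
theorem exists_universal_weighted {P : Distribution} (hP : ComputableDistribution P)
    {ι β : Type} [Primcodable ι] [Primcodable β] {k : ι × β → ℕ} {x : ι × β → List Bool}
    (hk : Computable k) (hx : Computable x) (B : ℕ) :
    ∃ T : (ℕ × ι) × β → Prop, REPred T ∧
      (∀ e i, ∑' b, {b | T ((e, i), b)}.indicator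
        (fun b => 2 ^ k (i, b) * (P : Measure Cantor) (interval (x (i, b)))) b ≤ B + 1) ∧
      ∀ A : ι × β → Prop, REPred A →
        (∀ i, ∑' b, {b | A (i, b)}.indicator
          (fun b => 2 ^ k (i, b) * (P : Measure Cantor) (interval (x (i, b)))) b ≤ B) →
        ∃ e, ∀ i b, T ((e, i), b) ↔ A (i, b) := by
  obtain ⟨u, hu, hle, hlim⟩ := hP.exists_upper_approx
  have hw : Computable₂ fun (c : ι × β) (m : ℕ) => 2 ^ k c * u (x c) m :=
    Primrec.nat_mul.to_comp.comp (Computable.two_pow (hk.comp Computable.fst))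
      (hu.comp (hx.comp Computable.fst) Computable.snd)
  have hcast : ∀ (c : ι × β) (m : ℕ), (((2 ^ k c * u (x c) m : ℕ) : ℝ≥0∞)) / 2 ^ m =
      2 ^ k c * ((u (x c) m : ℝ≥0∞) / 2 ^ m) := by
    intro c m
    push_cast
    rw [mul_div_assoc]
  refine ⟨TrimmedMem (fun c m => 2 ^ k c * u (x c) m) B, rePred_trimmedMem hw B,
    tsum_trimmedMem_le (W := fun c => 2 ^ k c * (P : Measure Cantor) (interval (x c)))
      (fun c m => ?_) B,
    fun A hA hB => exists_trimmedMem_iff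
      (W := fun c => 2 ^ k c * (P : Measure Cantor) (interval (x c))) (fun c => ?_) hA hB⟩
  · rw [hcast]
    gcongr
    exact hle _ m
  · simp only [hcast]
    exact ENNReal.Tendsto.const_mul (hlim _) (Or.inr (by simp))

theorem tsum_two_inv_pow (n : ℕ) : ∑' d : ℕ, (2⁻¹ : ℝ≥0∞) ^ (n + d) = 2⁻¹ ^ n * 2 := by
  simp only [pow_add]
  rw [ENNReal.tsum_mul_left, ENNReal.tsum_geometric, ENNReal.one_sub_inv_two, inv_inv]

theorem le_mlDeficiency {U : ℕ → Set Cantor} {ω : Cantor} {n : ℕ} (h : ω ∈ U n) :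
    (n : ℕ∞) ≤ mlDeficiency U ω :=
  le_iSup₂_of_le (f := fun i (_ : i ∈ {i : ℕ | ω ∈ U i}) => (i : ℕ∞)) n h le_rfl

/-- The universal Martin-Löf test collects the trimmed tests, the `e`-th one being shifted by
`e + 3` levels. A trimmed level `i` has probability at most `2 * 2⁻¹ ^ i`, and including all deeper
levels `n + d`, which makes the family decreasing, costs one more factor `2`; so the sum over `e` is
at most `2⁻¹ ^ n`. -/
theorem exists_isUniversalMLTest {P : Distribution} (hP : ComputableDistribution P) :
    ∃ U, IsUniversalMLTest {P} U := by
  obtain ⟨T, hT, hTle, hTuniv⟩ := exists_universal_weighted hP (ι := ℕ) (β := List Bool)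
    (k := Prod.fst) (x := Prod.snd) Computable.fst Computable.snd 1
  let U : ℕ → Set Cantor := fun n =>
    {ω | ∃ x, ∃ q : ℕ × ℕ, T ((q.1, n + q.2 + (q.1 + 3)), x) ∧ ω ∈ interval x}
  have hanti : Antitone U := by
    rintro m n hmn ω ⟨x, ⟨e, d⟩, hx, hω⟩
    refine ⟨x, (e, n - m + d), ?_, hω⟩
    have : m + (n - m + d) + (e + 3) = n + d + (e + 3) := by omega
    rw [this]
    exact hx
  have hopen : UniformlyEffectivelyOpen U := by
    refine uniformlyEffectivelyOpen_of_re (κ := ℕ × ℕ) (A := fun p =>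
      T ((p.2.1, p.1.1 + p.2.2 + (p.2.1 + 3)), p.1.2)) ?_ fun i => rfl
    have he : Computable fun p : (ℕ × List Bool) × (ℕ × ℕ) => p.2.1 :=
      Computable.fst.comp Computable.snd
    have hd : Computable fun p : (ℕ × List Bool) × (ℕ × ℕ) => p.2.2 :=
      Computable.snd.comp Computable.snd
    have hn : Computable fun p : (ℕ × List Bool) × (ℕ × ℕ) => p.1.1 :=
      Computable.fst.comp Computable.fst
    have hx : Computable fun p : (ℕ × List Bool) × (ℕ × ℕ) => p.1.2 :=
      Computable.snd.comp Computable.fst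
    have hsum : Computable fun p : (ℕ × List Bool) × (ℕ × ℕ) =>
        p.1.1 + p.2.2 + (p.2.1 + 3) :=
      Primrec.nat_add.to_comp.comp (Primrec.nat_add.to_comp.comp hn hd)
        (Primrec.nat_add.to_comp.comp he (Computable.const 3))
    exact hT.comp' (f := fun p : (ℕ × List Bool) × (ℕ × ℕ) =>
      ((p.2.1, p.1.1 + p.2.2 + (p.2.1 + 3)), p.1.2)) ((he.pair hsum).pair hx)
  have hlevel : ∀ e i, (P : Measure Cantor) {ω | ∃ x, T ((e, i), x) ∧ ω ∈ interval x} ≤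
      2⁻¹ ^ i * 2 := by
    intro e i
    have h1 : (P : Measure Cantor) {ω | ∃ x, T ((e, i), x) ∧ ω ∈ interval x} ≤
        ∑' x, {x | T ((e, i), x)}.indicator (fun x => (P : Measure Cantor) (interval x)) x := by
      have : {ω | ∃ x, T ((e, i), x) ∧ ω ∈ interval x} =
          ⋃ x : {x | T ((e, i), x)}, interval x := by
        ext ω
        simp
      rw [this, ← tsum_subtype {x | T ((e, i), x)} fun x => (P : Measure Cantor) (interval x)]
      exact measure_iUnion_le _
    have h2 := hTle e i
    have h3 : ∀ x, {x | T ((e, i), x)}.indicator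
        (fun x => (2 : ℝ≥0∞) ^ i * (P : Measure Cantor) (interval x)) x =
        2 ^ i * {x | T ((e, i), x)}.indicator (fun x => (P : Measure Cantor) (interval x)) x := by
      intro x
      by_cases hx : x ∈ {x | T ((e, i), x)}
      · simp only [Set.indicator_of_mem hx]
      · simp only [Set.indicator_of_notMem hx, mul_zero]
    simp only [h3, ENNReal.tsum_mul_left] at h2
    rw [← ENNReal.inv_pow, mul_comm, ← div_eq_mul_inv, ENNReal.le_div_iff_mul_le (by simp) (by simp),
      mul_comm]
    refine (mul_le_mul_right h1 _).trans (h2.trans ?_)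
    norm_num
  have hmeas : ∀ n, (P : Measure Cantor) (U n) ≤ 2⁻¹ ^ n := by
    intro n
    have hU : U n = ⋃ e, ⋃ d, {ω | ∃ x, T ((e, n + d + (e + 3)), x) ∧ ω ∈ interval x} := by
      ext ω
      simp only [U, Set.mem_ofPred_eq, Set.mem_iUnion, Prod.exists]
      constructor
      · rintro ⟨x, e, d, h⟩
        exact ⟨e, d, x, h⟩
      · rintro ⟨e, d, x, h⟩
        exact ⟨x, e, d, h⟩
    rw [hU]
    calc _ ≤ ∑' e : ℕ, ∑' d : ℕ, (2⁻¹ : ℝ≥0∞) ^ (n + d + (e + 3)) * 2 := by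
          refine (measure_iUnion_le _).trans (ENNReal.tsum_le_tsum fun e => ?_)
          exact (measure_iUnion_le _).trans (ENNReal.tsum_le_tsum fun d => hlevel e _)
      _ = ∑' e : ℕ, (2⁻¹ : ℝ≥0∞) ^ (n + 1 + e) := by
          refine tsum_congr fun e => ?_
          have : ∀ d, (2⁻¹ : ℝ≥0∞) ^ (n + d + (e + 3)) * 2 = 2⁻¹ ^ ((n + e + 2) + d) := by
            intro d
            rw [show n + d + (e + 3) = (n + e + 2) + d + 1 by ring, pow_succ, mul_assoc,
              ENNReal.inv_mul_cancel (by simp) (by simp), mul_one]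
          simp only [this, tsum_two_inv_pow]
          rw [show n + e + 2 = n + 1 + e + 1 by ring, pow_succ _ (n + 1 + e), mul_assoc,
            ENNReal.inv_mul_cancel (by simp) (by simp), mul_one]
      _ = 2⁻¹ ^ n := by
          rw [tsum_two_inv_pow, pow_succ, mul_assoc,
            ENNReal.inv_mul_cancel (by simp) (by simp), mul_one]
  refine ⟨U, ⟨hanti, hopen, ?_⟩, fun V hV => ?_⟩
  · rintro Q rfl i
    exact hmeas i
  · obtain ⟨A, hA, hAV, hAd⟩ := hV.2.1.exists_disjoint
    obtain ⟨e, he⟩ := hTuniv A hA fun i => by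
      dsimp only
      rw [tsum_indicator_interval_eq _ (hAV i) (hAd i)]
      calc _ ≤ (2 : ℝ≥0∞) ^ i * 2⁻¹ ^ i := by
            gcongr
            exact hV.2.2 P rfl i
        _ = ((1 : ℕ) : ℝ≥0∞) := by
            rw [← mul_pow, ENNReal.mul_inv_cancel (by simp) (by simp), one_pow, Nat.cast_one]
    refine ⟨e + 3, fun ω => iSup₂_le fun i hi => ?_⟩
    rcases le_total i (e + 3) with h | h
    · exact le_add_left (by exact_mod_cast h)
    · have hi' : ω ∈ V i := hi
      rw [hAV] at hi'
      obtain ⟨x, hx, hω⟩ := hi'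
      have hmem : ω ∈ U (i - (e + 3)) := by
        refine ⟨x, (e, 0), ?_, hω⟩
        have : i - (e + 3) + 0 + (e + 3) = i := by omega
        simp only [this]
        exact (he i x).2 hx
      calc (i : ℕ∞) = ((i - (e + 3) : ℕ) : ℕ∞) + ((e + 3 : ℕ) : ℕ∞) := by
            rw [← Nat.cast_add, Nat.sub_add_cancel h]
        _ ≤ _ := by
            gcongr
            exact le_mlDeficiency hmem

theorem tsum_indicator_two_pow_le (g : ℝ≥0∞) :
    ∑' k : ℕ, {k : ℕ | (2 : ℝ≥0∞) ^ k ≤ g}.indicator (fun k => (2 : ℝ≥0∞) ^ k) k ≤ 2 * g := by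
  refine ENNReal.tsum_le_of_sum_range_le fun n => ?_
  induction n with
  | zero => simp
  | succ n ih =>
    rw [Finset.sum_range_succ]
    by_cases h : (2 : ℝ≥0∞) ^ n ≤ g
    · have h1 : ∀ n : ℕ, ∑ k ∈ Finset.range n,
          {k : ℕ | (2 : ℝ≥0∞) ^ k ≤ g}.indicator (fun k => (2 : ℝ≥0∞) ^ k) k ≤ 2 ^ n := by
        intro n
        induction n with
        | zero => simp
        | succ n ih =>
          rw [Finset.sum_range_succ, pow_succ, mul_two]
          exact add_le_add ih (Set.indicator_le_self _ _ _)
      rw [Set.indicator_of_mem (by exact h), two_mul]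
      exact add_le_add ((h1 n).trans h) h
    · rw [Set.indicator_of_notMem (by exact h), add_zero]
      exact ih

theorem le_two_mul_of_two_pow_le {g s : ℝ≥0∞} (h0 : 1 ≤ s)
    (h : ∀ k : ℕ, (2 : ℝ≥0∞) ^ k < g → 2 ^ k ≤ s) : g ≤ 2 * s := by
  by_contra! hlt
  have hs : s ≠ ⊤ := by
    rintro rfl
    simp at hlt
  have hex : ∃ k : ℕ, s < (2 : ℝ≥0∞) ^ k := by
    obtain ⟨n, hn⟩ := ENNReal.exists_nat_gt hs
    exact ⟨n, hn.trans (by exact_mod_cast n.lt_two_pow_self)⟩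
  classical
  -- The least power of two above `s` is at most `2 * s`, hence below `g`.
  obtain ⟨hk, hmin⟩ := Nat.find_spec hex, fun m => Nat.find_min (m := m) hex
  cases hn : Nat.find hex with
  | zero =>
    rw [hn, pow_zero] at hk
    exact absurd hk (not_lt.2 h0)
  | succ n =>
    have h1 : (2 : ℝ≥0∞) ^ n ≤ s := not_lt.1 (hmin n (by omega))
    have h2 : (2 : ℝ≥0∞) ^ (n + 1) < g := by
      rw [pow_succ, mul_comm]
      exact (mul_le_mul_right h1 2).trans_lt hlt
    rw [hn] at hk
    exact absurd hk (not_lt.2 (h _ h2))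

/-- The levels `{2 ^ k - 1 < t}` of an expectation-bounded test, the level zero being replaced by
the whole space, are disjoint unions of intervals whose total weight `∑ 2 ^ k * P [x]` is at most
`4`: at each point the sum of `2 ^ k` over the levels is at most `2 * (t + 1)`. The level zero serves
the points at which `t` is small, so that the maximal test is bounded away from zero there. -/
theorem exists_levels_of_isExpTest {P : Distribution} {t : Cantor → ℝ≥0∞} (ht : IsExpTest {P} t) :
    ∃ A : ℕ × List Bool → Prop, REPred A ∧
      ∑' b, {b | A b}.indicator
        (fun b => 2 ^ b.1 * (P : Measure Cantor) (interval b.2)) b ≤ 4 ∧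
      ∀ ω (k : ℕ), (k = 0 ∨ (2 : ℝ≥0∞) ^ k < t ω) → ∃ x, A (k, x) ∧ ω ∈ interval x := by
  have hl : UniformlyEffectivelyOpen fun r : ℕ × ℕ =>
    {ω | (r.1 : ℝ≥0∞) / ((r.2 : ℝ≥0∞) + 1) < t ω} := ht.1
  obtain ⟨A₀, hA₀, hA₀V⟩ := hl.comp (f := fun k : ℕ => (2 ^ k - 1, 0))
    ((Primrec.nat_sub.to_comp.comp (Computable.two_pow Computable.id) (Computable.const 1)).pair
      (Computable.const 0))
  have hV : UniformlyEffectivelyOpen fun k : ℕ =>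
      {ω | k = 0 ∨ ((2 ^ k - 1 : ℕ) : ℝ≥0∞) < t ω} := by
    refine ⟨fun p => p.1 = 0 ∨ A₀ p,
      (ComputablePred.eq_comp Computable.fst (Computable.const 0)).to_re.or' hA₀, fun k => ?_⟩
    ext ω
    have hA := Set.ext_iff.1 (hA₀V k) ω
    simp only [Set.mem_ofPred_eq, CharP.cast_eq_zero, zero_add, div_one] at hA ⊢
    rw [hA]
    constructor
    · rintro (h | ⟨x, hx, hω⟩)
      · exact ⟨[], Or.inl h, by simp⟩
      · exact ⟨x, Or.inr hx, hω⟩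
    · rintro ⟨x, h | hx, hω⟩
      · exact Or.inl h
      · exact Or.inr ⟨x, hx, hω⟩
  obtain ⟨A, hA, hAV, hAd⟩ := hV.exists_disjoint
  refine ⟨A, hA, ?_, fun ω k hk => ?_⟩
  · rw [ENNReal.tsum_prod']
    calc _ = ∑' k : ℕ, 2 ^ k * (P : Measure Cantor)
            {ω | k = 0 ∨ ((2 ^ k - 1 : ℕ) : ℝ≥0∞) < t ω} :=
          tsum_congr fun k => tsum_indicator_interval_eq _ (hAV k) (hAd k) _
      _ ≤ ∑' k : ℕ, ∫⁻ ω, {k : ℕ | (2 : ℝ≥0∞) ^ k ≤ t ω + 1}.indicator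
            (fun k => (2 : ℝ≥0∞) ^ k) k ∂(P : Measure Cantor) := by
          refine ENNReal.tsum_le_tsum fun k => ?_
          rw [← lintegral_indicator_const (hV.measurableSet k)]
          refine lintegral_mono fun ω => ?_
          by_cases hω : ω ∈ {ω | k = 0 ∨ ((2 ^ k - 1 : ℕ) : ℝ≥0∞) < t ω}
          · have hk : k ∈ {k : ℕ | (2 : ℝ≥0∞) ^ k ≤ t ω + 1} := by
              rcases hω with rfl | h
              · simp
              · calc (2 : ℝ≥0∞) ^ k = ((2 ^ k - 1 : ℕ) : ℝ≥0∞) + 1 := by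
                      exact_mod_cast (Nat.sub_add_cancel Nat.one_le_two_pow).symm
                  _ ≤ t ω + 1 := by gcongr
            rw [Set.indicator_of_mem hω, Set.indicator_of_mem hk]
          · rw [Set.indicator_of_notMem hω]
            exact zero_le
      _ = ∫⁻ ω, ∑' k : ℕ, {k : ℕ | (2 : ℝ≥0∞) ^ k ≤ t ω + 1}.indicator
            (fun k => (2 : ℝ≥0∞) ^ k) k ∂(P : Measure Cantor) := by
          refine (lintegral_tsum fun k => ?_).symm
          have hm : MeasurableSet {ω | (2 : ℝ≥0∞) ^ k ≤ t ω + 1} :=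
            measurableSet_le measurable_const (ht.1.measurable.add_const 1)
          exact ((measurable_const (a := (2 : ℝ≥0∞) ^ k)).indicator hm).aemeasurable
      _ ≤ ∫⁻ ω, 2 * (t ω + 1) ∂(P : Measure Cantor) :=
          lintegral_mono fun ω => tsum_indicator_two_pow_le _
      _ ≤ 4 := by
          rw [lintegral_const_mul _ (ht.1.measurable.add_const 1),
            lintegral_add_right _ measurable_const]
          simp only [lintegral_const, measure_univ, mul_one]
          calc _ ≤ (2 : ℝ≥0∞) * (1 + 1) := by
                gcongr
                exact ht.2 P rfl
            _ = 4 := by norm_num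
  · have : ω ∈ {ω | k = 0 ∨ ((2 ^ k - 1 : ℕ) : ℝ≥0∞) < t ω} :=
      hk.imp_right fun h => lt_of_le_of_lt (by exact_mod_cast Nat.sub_le _ _) h
    rw [hAV] at this
    exact this

/-- The maximal expectation-bounded test is the supremum of the trimmed tests, the `e`-th one being
multiplied by `2 ^ (-(e + 4))`. A trimmed test has integral at most `4 + 1`, and
`∑ 5 * 2 ^ (-(e + 4)) = 5 / 8`. -/
theorem exists_isMaximalExpTest {P : Distribution} (hP : ComputableDistribution P) :
    ∃ t, IsMaximalExpTest {P} t := by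
  obtain ⟨T, hT, hTle, hTuniv⟩ := exists_universal_weighted hP (ι := Unit) (β := ℕ × List Bool)
    (k := fun c => c.2.1) (x := fun c => c.2.2) (Computable.fst.comp Computable.snd)
    (Computable.snd.comp Computable.snd) 4
  let t : Cantor → ℝ≥0∞ := fun ω => ⨆ (e : ℕ) (b : ℕ × List Bool)
    (_ : T ((e, ()), b) ∧ ω ∈ interval b.2), 2 ^ b.1 / 2 ^ (e + 4)
  have hlsc : LowerSemicomputable t := by
    refine uniformlyEffectivelyOpen_of_re (κ := ℕ × ℕ) (A := fun p =>
      T ((p.2.1, ()), (p.2.2, p.1.2)) ∧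
        p.1.1.1 * 2 ^ (p.2.1 + 4) < 2 ^ p.2.2 * (p.1.1.2 + 1)) ?_ fun r => ?_
    · have he : Computable fun p : ((ℕ × ℕ) × List Bool) × (ℕ × ℕ) => p.2.1 :=
        Computable.fst.comp Computable.snd
      have hk : Computable fun p : ((ℕ × ℕ) × List Bool) × (ℕ × ℕ) => p.2.2 :=
        Computable.snd.comp Computable.snd
      have ha : Computable fun p : ((ℕ × ℕ) × List Bool) × (ℕ × ℕ) => p.1.1.1 :=
        Computable.fst.comp (Computable.fst.comp Computable.fst)
      have hb : Computable fun p : ((ℕ × ℕ) × List Bool) × (ℕ × ℕ) => p.1.1.2 :=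
        Computable.snd.comp (Computable.fst.comp Computable.fst)
      have hx : Computable fun p : ((ℕ × ℕ) × List Bool) × (ℕ × ℕ) => p.1.2 :=
        Computable.snd.comp Computable.fst
      refine REPred.and' (hT.comp' (f := fun p : ((ℕ × ℕ) × List Bool) × (ℕ × ℕ) =>
        ((p.2.1, ()), (p.2.2, p.1.2))) ((he.pair (Computable.const ())).pair (hk.pair hx)))
        (ComputablePred.lt_comp ?_ ?_).to_re
      · exact Primrec.nat_mul.to_comp.comp ha
          (Computable.two_pow (Primrec.nat_add.to_comp.comp he (Computable.const 4)))
      · exact Primrec.nat_mul.to_comp.comp (Computable.two_pow hk) (Computable.succ.comp hb)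
    · have hiff : ∀ e k : ℕ, (r.1 : ℝ≥0∞) / ((r.2 : ℝ≥0∞) + 1) < 2 ^ k / 2 ^ (e + 4) ↔
          r.1 * 2 ^ (e + 4) < 2 ^ k * (r.2 + 1) := by
        intro e k
        rw [ENNReal.div_lt_iff (by simp) (by simp), ← ENNReal.mul_div_right_comm,
          ENNReal.lt_div_iff_mul_lt (by simp) (by simp)]
        exact_mod_cast Iff.rfl
      ext ω
      simp only [t, Set.mem_ofPred_eq, lt_iSup_iff, exists_prop, Prod.exists, hiff]
      constructor
      · rintro ⟨e, k, x, ⟨h1, h2⟩, h3⟩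
        exact ⟨x, e, k, ⟨h1, h3⟩, h2⟩
      · rintro ⟨x, e, k, ⟨h1, h3⟩, h2⟩
        exact ⟨e, k, x, ⟨h1, h2⟩, h3⟩
  refine ⟨t, ⟨hlsc, ?_⟩, fun t' ht' => ?_⟩
  · rintro Q rfl
    have hpt : ∀ ω, t ω ≤ ∑' e : ℕ, 2⁻¹ ^ (e + 4) * ∑' b : ℕ × List Bool,
        {b | T ((e, ()), b)}.indicator
          (fun b => (interval b.2).indicator (fun _ => 2 ^ b.1) ω) b := by
      intro ω
      refine iSup_le fun e => iSup₂_le fun b hb => ?_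
      refine le_trans ?_ (ENNReal.le_tsum e)
      rw [div_eq_mul_inv, mul_comm, ENNReal.inv_pow]
      gcongr
      refine le_trans ?_ (ENNReal.le_tsum b)
      rw [Set.indicator_of_mem (by exact hb.1), Set.indicator_of_mem hb.2]
    have hm : ∀ (e : ℕ) (b : ℕ × List Bool), Measurable fun ω : Cantor =>
        {b | T ((e, ()), b)}.indicator
          (fun b => (interval b.2).indicator (fun _ => (2 : ℝ≥0∞) ^ b.1) ω) b := by
      intro e b
      by_cases hb : T ((e, ()), b)
      · have : b ∈ {b | T ((e, ()), b)} := hb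
        simp only [Set.indicator_of_mem this]
        exact measurable_const.indicator (measurableSet_interval _)
      · have : b ∉ {b | T ((e, ()), b)} := hb
        simp only [Set.indicator_of_notMem this]
        exact measurable_const
    refine (lintegral_mono hpt).trans ?_
    rw [lintegral_tsum fun e => ((Measurable.tsum (hm e)).const_mul _).aemeasurable]
    have hint : ∀ e : ℕ, ∫⁻ ω, 2⁻¹ ^ (e + 4) * ∑' b : ℕ × List Bool,
        {b | T ((e, ()), b)}.indicator
          (fun b => (interval b.2).indicator (fun _ => 2 ^ b.1) ω) b ∂(Q : Measure Cantor) ≤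
        2⁻¹ ^ (e + 4) * 5 := by
      intro e
      rw [lintegral_const_mul _ (Measurable.tsum (hm e)),
        lintegral_tsum fun b => (hm e b).aemeasurable]
      gcongr
      calc _ = ∑' b, {b | T ((e, ()), b)}.indicator
            (fun b => 2 ^ b.1 * (Q : Measure Cantor) (interval b.2)) b := by
            refine tsum_congr fun b => ?_
            by_cases hb : T ((e, ()), b)
            · have : b ∈ {b | T ((e, ()), b)} := hb
              simp only [Set.indicator_of_mem this]
              rw [lintegral_indicator_const (measurableSet_interval _)]
            · have : b ∉ {b | T ((e, ()), b)} := hb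
              simp only [Set.indicator_of_notMem this, lintegral_zero]
        _ ≤ (4 : ℕ) + 1 := hTle e ()
        _ = 5 := by norm_num
    calc _ ≤ ∑' e : ℕ, (2⁻¹ : ℝ≥0∞) ^ (e + 4) * 5 := ENNReal.tsum_le_tsum hint
      _ = 2⁻¹ ^ 3 * 5 := by
        simp only [add_comm _ 4]
        rw [ENNReal.tsum_mul_right, tsum_two_inv_pow, pow_succ _ 3, mul_assoc (2⁻¹ ^ 3),
          ENNReal.inv_mul_cancel (by simp) (by simp), mul_one]
      _ ≤ 1 := by
        rw [← ENNReal.inv_pow, mul_comm, ← div_eq_mul_inv]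
        refine ENNReal.div_le_of_le_mul ?_
        norm_num
  · obtain ⟨A, hA, hAle, hAt⟩ := exists_levels_of_isExpTest ht'
    obtain ⟨e, he⟩ := hTuniv (fun c => A c.2) (hA.comp' Computable.snd) fun _ => by
      exact_mod_cast hAle
    have hge : ∀ ω (k : ℕ), (k = 0 ∨ (2 : ℝ≥0∞) ^ k < t' ω) → 2 ^ k ≤ 2 ^ (e + 4) * t ω := by
      intro ω k hk
      obtain ⟨x, hx, hω⟩ := hAt ω k hk
      have h1 : (2 : ℝ≥0∞) ^ k / 2 ^ (e + 4) ≤ t ω :=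
        le_iSup_of_le e (le_iSup₂_of_le (k, x) ⟨(he () (k, x)).2 hx, hω⟩ le_rfl)
      rwa [ENNReal.div_le_iff (by simp) (by simp), mul_comm] at h1
    refine ⟨2 * 2 ^ (e + 4), fun ω => ?_⟩
    push_cast
    rw [mul_assoc]
    refine le_two_mul_of_two_pow_le ?_ fun k hk => hge ω k (Or.inr hk)
    simpa using hge ω 0 (Or.inl rfl)

/-! ### Expectation-bounded and probability-bounded tests -/

/-- The deficiency function of a Martin-Löf test is an expectation-bounded test, because its
integral is the sum of the probabilities of the levels `U (i + 1)`. -/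
theorem isExpTest_mlDeficiency {𝓛 : Set Distribution} {U : ℕ → Set Cantor} (hU : IsMLTest 𝓛 U) :
    IsExpTest 𝓛 fun ω => (mlDeficiency U ω : ℝ≥0∞) := by
  have hcoe : ∀ ω, (mlDeficiency U ω : ℝ≥0∞) = ⨆ i ∈ {i : ℕ | ω ∈ U i}, (i : ℝ≥0∞) := by
    intro ω
    simp only [mlDeficiency, ENat.toENNReal_iSup, ENat.toENNReal_coe]
  refine ⟨?_, fun Q hQ => ?_⟩
  · obtain ⟨A, hA, hAU⟩ := hU.2.1
    refine uniformlyEffectivelyOpen_of_re (κ := ℕ) (A := fun p =>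
      A (p.2, p.1.2) ∧ p.1.1.1 < p.2 * (p.1.1.2 + 1)) ?_ fun r => ?_
    · refine (hA.comp' (Computable.snd.pair (Computable.snd.comp Computable.fst))).and'
        (ComputablePred.lt_comp (Computable.fst.comp (Computable.fst.comp Computable.fst)) ?_).to_re
      exact Primrec.nat_mul.to_comp.comp Computable.snd
        (Computable.succ.comp (Computable.snd.comp (Computable.fst.comp Computable.fst)))
    · have hiff : ∀ i : ℕ, (r.1 : ℝ≥0∞) / ((r.2 : ℝ≥0∞) + 1) < i ↔ r.1 < i * (r.2 + 1) := by
        intro i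
        rw [ENNReal.div_lt_iff (by simp) (by simp)]
        exact_mod_cast Iff.rfl
      ext ω
      simp only [Set.mem_ofPred_eq, hcoe, lt_iSup_iff, exists_prop, hiff, hAU]
      constructor
      · rintro ⟨i, ⟨x, hx, hω⟩, h⟩
        exact ⟨x, i, ⟨hx, h⟩, hω⟩
      · rintro ⟨x, i, ⟨hx, h⟩, hω⟩
        exact ⟨i, ⟨x, hx, hω⟩, h⟩
  · have hm : ∀ i, MeasurableSet (U i) := hU.2.1.measurableSet
    have hpt : ∀ ω, (mlDeficiency U ω : ℝ≥0∞) ≤ ∑' j : ℕ, (U (j + 1)).indicator 1 ω := by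
      intro ω
      rw [hcoe]
      refine iSup₂_le fun i (hi : ω ∈ U i) => ?_
      calc (i : ℝ≥0∞) = ∑ j ∈ Finset.range i, (U (j + 1)).indicator 1 ω := by
            rw [Finset.sum_congr rfl fun j hj => Set.indicator_of_mem
              (hU.1 (Nat.succ_le_of_lt (Finset.mem_range.1 hj)) hi) 1]
            simp
        _ ≤ _ := ENNReal.sum_le_tsum _
    refine (lintegral_mono hpt).trans ?_
    rw [lintegral_tsum fun j => (measurable_one.indicator (hm _)).aemeasurable]
    simp only [lintegral_indicator_one (hm _)]
    calc _ ≤ ∑' j : ℕ, (2⁻¹ : ℝ≥0∞) ^ (1 + j) :=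
          ENNReal.tsum_le_tsum fun j => by
            rw [add_comm 1 j]
            exact hU.2.2 Q hQ _
      _ = 1 := by
          rw [tsum_two_inv_pow, pow_one, ENNReal.inv_mul_cancel (by simp) (by simp)]

/-- By Markov's inequality, the levels `{2 ^ i < t}` of an expectation-bounded test form a
Martin-Löf test. -/
theorem isMLTest_levels {𝓛 : Set Distribution} {t : Cantor → ℝ≥0∞} (ht : IsExpTest 𝓛 t) :
    IsMLTest 𝓛 fun i => {ω | (2 : ℝ≥0∞) ^ i < t ω} := by
  refine ⟨fun i j hij ω (hω : (2 : ℝ≥0∞) ^ j < t ω) =>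
    (pow_le_pow_right₀ (by norm_num) hij).trans_lt hω, ?_,
    fun Q hQ i => ?_⟩
  · have hl : UniformlyEffectivelyOpen fun r : ℕ × ℕ =>
      {ω | (r.1 : ℝ≥0∞) / ((r.2 : ℝ≥0∞) + 1) < t ω} := ht.1
    have := hl.comp (f := fun i : ℕ => (2 ^ i, 0))
      ((Computable.two_pow Computable.id).pair (Computable.const 0))
    simpa using this
  · rw [← ENNReal.inv_pow, ENNReal.le_inv_iff_mul_le, mul_comm]
    calc _ ≤ 2 ^ i * (Q : Measure Cantor) {ω | (2 : ℝ≥0∞) ^ i ≤ t ω} := by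
          refine mul_le_mul_right (measure_mono fun ω hω => ?_) _
          exact le_of_lt (α := ℝ≥0∞) hω
      _ ≤ _ := mul_meas_ge_le_lintegral ht.1.measurable _
      _ ≤ 1 := ht.2 Q hQ

theorem mlDeficiency_lt_top_iff {U : ℕ → Set Cantor} (hU : Antitone U) {ω : Cantor} :
    mlDeficiency U ω < ⊤ ↔ ∃ i, ω ∉ U i := by
  constructor
  · intro h
    by_contra! hall
    refine absurd h (not_lt.2 (top_le_iff.2 (ENat.eq_top_iff_forall_ge.2 fun n => ?_)))
    exact le_mlDeficiency (hall n)
  · rintro ⟨i, hi⟩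
    refine lt_of_le_of_lt (iSup₂_le fun j (hj : ω ∈ U j) => ?_) (ENat.natCast_lt_top i)
    have : j ≤ i := by
      by_contra! hlt
      exact hi (hU hlt.le hj)
    exact_mod_cast this

/-- The two notions of randomness with respect to a class coincide as soon as a maximal
expectation-bounded test exists. -/
theorem isMLRandom_iff_lt_top {𝓛 : Set Distribution} {t : Cantor → ℝ≥0∞}
    (ht : IsMaximalExpTest 𝓛 t) {ω : Cantor} : IsMLRandom 𝓛 ω ↔ t ω < ⊤ := by
  constructor
  · intro h
    obtain ⟨i, hi⟩ := h _ (isMLTest_levels ht.1)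
    exact (not_lt.1 hi).trans_lt (by simp)
  · intro h U hU
    rw [← mlDeficiency_lt_top_iff hU.1]
    obtain ⟨c, hc⟩ := ht.2 _ (isExpTest_mlDeficiency hU)
    exact ENat.toENNReal_lt_top.1 ((hc ω).trans_lt (ENNReal.mul_lt_top (by simp) h))

theorem isClassRandom_iff_lt_top {𝓛 : Set Distribution} {t : Cantor → ℝ≥0∞}
    (ht : IsMaximalExpTest 𝓛 t) {ω : Cantor} : IsClassRandom 𝓛 ω ↔ t ω < ⊤ := by
  constructor
  · rintro ⟨s, hs, h⟩
    obtain ⟨c, hc⟩ := hs.2 t ht.1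
    exact (hc ω).trans_lt (ENNReal.mul_lt_top (by simp) h)
  · exact fun h => ⟨t, ht, h⟩

/-! ### Transfer of maximality and comparison of deficiencies -/

section Transfer

variable {P : Distribution} {F : Set (Cantor × Cantor)}

/-- Every test of the class is dominated, along `F`, by the maximal `P`-test. -/
theorem AlgRand.IsMaximalExpTest.exists_le_of_mem (hF : EffectivelyClosed F)
    (hproj : ∀ α, ∃ β, (α, β) ∈ F) (hpre : ComputableClopenPreimages F) {tP t : Cantor → ℝ≥0∞}
    (hP : IsMaximalExpTest {P} tP) (ht : IsExpTest (couplable F P) t) :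
    ∃ c : ℝ≥0, ∀ α β, (α, β) ∈ F → t β ≤ c * tP α := by
  obtain ⟨c, hc⟩ := hP.2 _ (isExpTest_supSection hF hproj hpre ht)
  exact ⟨c, fun α β h => (le_iSup₂_of_le (f := fun β (_ : β ∈ {β | (α, β) ∈ F}) => t β)
    β h le_rfl).trans (hc α)⟩

theorem AlgRand.IsMaximalExpTest.infSection (hF : EffectivelyClosed F)
    (hproj : ∀ α, ∃ β, (α, β) ∈ F) (hpre : ComputableClopenPreimages F) {tP : Cantor → ℝ≥0∞}
    (hP : IsMaximalExpTest {P} tP) : IsMaximalExpTest (couplable F P) (_root_.infSection F tP) := by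
  refine ⟨isExpTest_infSection hF hP.1, fun t ht => ?_⟩
  obtain ⟨c, hc⟩ := hP.exists_le_of_mem hF hproj hpre ht
  -- A positive constant is needed: the infimum over an empty section is infinite.
  refine ⟨c + 1, fun β => ?_⟩
  by_cases hne : {α | (α, β) ∈ F}.Nonempty
  · obtain ⟨α, hα, he⟩ := exists_eq_infSection hF hP.1.1 hne
    rw [← he]
    refine (hc α β hα).trans ?_
    gcongr
    simp
  · rw [infSection_eq_top hne, ENNReal.mul_top (by simp)]
    exact le_top

theorem mlDeficiency_relCore {U : ℕ → Set Cantor} (hU : Antitone U) (β : Cantor) :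
    mlDeficiency (fun i => relCore F (U i)) β = ⨅ α ∈ {α | (α, β) ∈ F}, mlDeficiency U α := by
  refine le_antisymm (le_iInf₂ fun α hα => iSup₂_le fun i hi => le_mlDeficiency (hi α hα)) ?_
  refine ENat.forall_natCast_le_iff_le.1 fun n hn => ?_
  cases n with
  | zero => simp
  | succ n =>
    refine le_mlDeficiency (U := fun i => relCore F (U i)) fun α hα => ?_
    by_contra hnot
    have h1 : ((n + 1 : ℕ) : ℕ∞) ≤ mlDeficiency U α := hn.trans (iInf₂_le α hα)
    have h2 : mlDeficiency U α ≤ n := iSup₂_le fun j (hj : α ∈ U j) => by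
      have : j ≤ n := by
        by_contra! hlt
        exact hnot (hU hlt hj)
      exact_mod_cast this
    have := h1.trans h2
    norm_cast at this
    omega

theorem mlDeficiency_le_relPreimage {U : ℕ → Set Cantor} {α β : Cantor} (h : (α, β) ∈ F) :
    mlDeficiency U β ≤ mlDeficiency (fun i => relPreimage F (U i)) α :=
  iSup₂_le fun _ hi =>
    le_mlDeficiency (U := fun i => relPreimage F (U i)) ⟨β, hi, h⟩

/-- Every Martin-Löf test of the class is dominated by the smallest `P`-deficiency on the section.
-/
theorem AlgRand.IsUniversalMLTest.exists_le_iInf (hF : EffectivelyClosed F)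
    (hproj : ∀ α, ∃ β, (α, β) ∈ F) (hpre : ComputableClopenPreimages F) {UP U : ℕ → Set Cantor}
    (hP : IsUniversalMLTest {P} UP) (hU : IsMLTest (couplable F P) U) :
    ∃ c : ℕ, ∀ β, mlDeficiency U β ≤ (⨅ α ∈ {α | (α, β) ∈ F}, mlDeficiency UP α) + c := by
  obtain ⟨c, hc⟩ := hP.2 _ (isMLTest_relPreimage hF hproj hpre hU)
  refine ⟨c, fun β => ?_⟩
  rw [← tsub_le_iff_right]
  refine le_iInf₂ fun α hα => ?_
  rw [tsub_le_iff_right]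
  exact (mlDeficiency_le_relPreimage hα).trans (hc α)

theorem AlgRand.IsUniversalMLTest.relCore (hF : EffectivelyClosed F)
    (hproj : ∀ α, ∃ β, (α, β) ∈ F) (hpre : ComputableClopenPreimages F) {UP : ℕ → Set Cantor}
    (hP : IsUniversalMLTest {P} UP) :
    IsUniversalMLTest (couplable F P) fun i => _root_.relCore F (UP i) := by
  refine ⟨isMLTest_relCore hF hP.1, fun V hV => ?_⟩
  obtain ⟨c, hc⟩ := hP.exists_le_iInf hF hproj hpre hV
  refine ⟨c, fun β => ?_⟩
  rw [mlDeficiency_relCore hP.1.1]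
  exact hc β

end Transfer

/-- A constant factor between tests is an additive constant between deficiencies. -/
theorem expDeficiency_le_add {s t : Cantor → ℝ≥0∞} {ω ω' : Cantor} {c : ℝ≥0} (hc : 0 < c)
    (h : s ω ≤ c * t ω') :
    expDeficiency s ω ≤ expDeficiency t ω' + ((Real.log c / Real.log 2 : ℝ) : EReal) := by
  have h2 : (0 : EReal) ≤ ((Real.log 2 : ℝ) : EReal) := by
    exact_mod_cast (Real.log_pos one_lt_two).le
  have hlog : ENNReal.log (c : ℝ≥0∞) = ((Real.log c : ℝ) : EReal) := by
    rw [← ENNReal.log_ofReal_of_pos (by exact_mod_cast hc), ENNReal.ofReal_coe_nnreal]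
  unfold expDeficiency
  rw [EReal.coe_div, ← hlog, ← EReal.add_div_of_nonneg_right h2, ← ENNReal.log_mul_add]
  refine EReal.div_le_div_right_of_nonneg h2 (ENNReal.log_monotone ?_)
  rwa [mul_comm]

theorem mainTheorem3 (P : Distribution) (hP : ComputableDistribution P)
    (F : Set (Cantor × Cantor)) (hF : EffectivelyClosed F)
    (hproj : ∀ α, ∃ β, (α, β) ∈ F) (hpre : ComputableClopenPreimages F) :
    -- expectation-bounded deficiencies
    ((∃ tP, IsMaximalExpTest {P} tP) ∧ (∃ tL, IsMaximalExpTest (couplable F P) tL) ∧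
      ∀ tP tL, IsMaximalExpTest {P} tP → IsMaximalExpTest (couplable F P) tL →
        ∃ C : ℝ, ∀ β,
          expDeficiency tL β ≤ (⨅ α ∈ {α | (α, β) ∈ F}, expDeficiency tP α) + (C : EReal) ∧
          (⨅ α ∈ {α | (α, β) ∈ F}, expDeficiency tP α) ≤ expDeficiency tL β + (C : EReal)) ∧
    -- probability-bounded deficiencies
    ((∃ UP, IsUniversalMLTest {P} UP) ∧ (∃ UL, IsUniversalMLTest (couplable F P) UL) ∧
      ∀ UP UL, IsUniversalMLTest {P} UP → IsUniversalMLTest (couplable F P) UL →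
        ∃ C : ℕ, ∀ β,
          mlDeficiency UL β ≤ (⨅ α ∈ {α | (α, β) ∈ F}, mlDeficiency UP α) + (C : ℕ∞) ∧
          (⨅ α ∈ {α | (α, β) ∈ F}, mlDeficiency UP α) ≤ mlDeficiency UL β + (C : ℕ∞)) ∧
    -- random sequences
    (∀ β, IsClassRandom (couplable F P) β ↔ ∃ α, IsMLRandom {P} α ∧ (α, β) ∈ F) ∧
    (∀ β, IsMLRandom (couplable F P) β ↔ ∃ α, IsMLRandom {P} α ∧ (α, β) ∈ F) := by
  obtain ⟨t, ht⟩ := exists_isMaximalExpTest hP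
  obtain ⟨U, hU⟩ := exists_isUniversalMLTest hP
  have htL := ht.infSection hF hproj hpre
  have hrand : ∀ β, infSection F t β < ⊤ ↔ ∃ α, IsMLRandom {P} α ∧ (α, β) ∈ F := by
    intro β
    simp only [infSection, iInf_lt_iff, isMLRandom_iff_lt_top ht, Set.mem_ofPred_eq, exists_prop,
      and_comm]
  refine ⟨⟨⟨t, ht⟩, ⟨_, htL⟩, fun tP tL hP hL => ?_⟩,
    ⟨⟨U, hU⟩, ⟨_, hU.relCore hF hproj hpre⟩, fun UP UL hP hL => ?_⟩,
    fun β => (isClassRandom_iff_lt_top htL).trans (hrand β),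
    fun β => (isMLRandom_iff_lt_top htL).trans (hrand β)⟩
  · obtain ⟨c₁, h₁⟩ := hP.exists_le_of_mem hF hproj hpre hL.1
    obtain ⟨c₂, h₂⟩ := hL.2 _ (isExpTest_infSection hF hP.1)
    let c : ℝ≥0 := max 1 (max c₁ c₂)
    have hc : 0 < c := lt_of_lt_of_le one_pos (le_max_left _ _)
    have hc₁ : (c₁ : ℝ≥0∞) ≤ c :=
      ENNReal.coe_le_coe.2 ((le_max_left _ _).trans (le_max_right _ _))
    have hc₂ : (c₂ : ℝ≥0∞) ≤ c :=
      ENNReal.coe_le_coe.2 ((le_max_right _ _).trans (le_max_right _ _))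
    refine ⟨Real.log c / Real.log 2, fun β => ⟨?_, ?_⟩⟩
    · rw [← EReal.sub_le_iff_le_add (by simp) (by simp)]
      refine le_iInf₂ fun α hα => ?_
      rw [EReal.sub_le_iff_le_add (by simp) (by simp)]
      exact expDeficiency_le_add hc ((h₁ α β hα).trans (mul_le_mul_left hc₁ _))
    · refine le_trans ?_ (expDeficiency_le_add (s := infSection F tP) (ω := β) hc
        ((h₂ β).trans (mul_le_mul_left hc₂ _)))
      by_cases hne : {α | (α, β) ∈ F}.Nonempty
      · obtain ⟨α, hα, he⟩ := exists_eq_infSection hF hP.1.1 hne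
        refine (iInf₂_le α hα).trans_eq ?_
        rw [expDeficiency, expDeficiency, he]
      · rw [expDeficiency, infSection_eq_top hne, ENNReal.log_top, EReal.top_div_of_pos_ne_top
          (by exact_mod_cast Real.log_pos one_lt_two) (EReal.coe_ne_top _)]
        exact le_top
  · obtain ⟨c₁, h₁⟩ := hP.exists_le_iInf hF hproj hpre hL.1
    obtain ⟨c₂, h₂⟩ := hL.2 _ (isMLTest_relCore hF hP.1)
    refine ⟨max c₁ c₂, fun β => ⟨(h₁ β).trans ?_, ?_⟩⟩
    · gcongr
      exact le_max_left _ _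
    · rw [← mlDeficiency_relCore hP.1.1]
      refine (h₂ β).trans ?_
      gcongr
      exact le_max_right _ _
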